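/- Let $\Omega\subseteq\mathbb R^n$ be open. All functions of bounded variation on $\mathbb R$ are represented by their right-continuous representatives, $\mathrm{Tot.Var.}$ is the total variation on $\mathbb R$, and $\|u-w\|_{L^1}\in[0,\infty]$. A function is called piecewise constant if it has finitely many jumps. For $u^-,u^+\in\mathbb R^n$ the Riemann datum $(u^-,u^+)$ is the function equal to $u^-$ for $x<0$ and to $u^+$ for $x\ge 0$. A flux $f$ belongs to $\mathrm{Hyp}(\Omega)$ if $f$ is $C^1$ on $\Omega$, every $Df(u)$, $u\in\Omega$, is diagonalizable with real eigenvalues, and $f$ generates a Standard Riemann Semigroup $S^f:[0,\infty)\times\mathcal D^f\to\mathcal D^f$ in the following sense. The domain $\mathcal D^f$ is a set of functions of bounded variation, each with values in a compact subset of $\Omega$; for every compact $K\subseteq\Omega$ it contains all piecewise constant functions with values in $K$ and sufficiently small total variation; and it is closed under sampling: if $u\in\mathcal D^f$ and $\varphi:\mathbb R\to\mathbb R$ is nondecreasing, right continuous, and constant near $-\infty$ and near $+\infty$, then $u\circ\varphi\in\mathcal D^f$. Moreover: (i) $S^f_0=\mathrm{Id}$ and $S^f_t\circ S^f_s=S^f_{t+s}$;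 (ii) there is a constant $L_f>0$ with $\|S^f_tu-S^f_sw\|_{L^1}\le L_f\,(|t-s|+\|u-w\|_{L^1})$ for all $t,s\ge0$ and $u,w\in\mathcal D^f$; (iii) there are a bound $\hat\lambda>0$ for the wave speeds and, for each Riemann datum $(u^-,u^+)\in\mathcal D^f$, a standard (Lax, Liu) self-similar entropic solution $\omega(x/t)$ of the Riemann problem, with $\omega(\xi)=u^-$ for $\xi\le-\hat\lambda$ and $\omega(\xi)=u^+$ for $\xi\ge\hat\lambda$, such that for every piecewise constant $u\in\mathcal D^f$ and every $t>0$ so small that any two jumps of $u$ are more than $2\hat\lambda t$ apart, $S^f_tu$ is the glueing of the solutions of the Riemann problems at the jumps of $u$; and $S^f$ has finite propagation speed: if $u,w\in\mathcal D^f$ coincide on $(a,b)$, then $S^f_tu$ and $S^f_tw$ coincide on $(a+\hat\lambda t,b-\hat\lambda t)$. Here a standard solution has a right-continuous profile $\omega$ of bounded variation with values in $\Omega$, which outside finitely many points is differentiable with $Df(\omega(\xi))\omega'(\xi)=\xi\,\omega'(\xi)$ (constant states and centered rarefactions), and which at each of these points $\sigma$ is either continuous or has a jump from $u_l$ to $u_r$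 that satisfies the Rankine–Hugoniot condition $f(u_r)-f(u_l)=\sigma(u_r-u_l)$ and Liu's entropy condition: $u_l$ and $u_r$ are joined by an arc in $\Omega$ of states $v$ with $f(v)-f(u_l)=s(v)\,(v-u_l)$ and $s(v)\ge\sigma$. **Theorem.** Let $f,g\in\mathrm{Hyp}(\Omega)$, with semigroups $S^f,S^g$ on domains $\mathcal D^g\subseteq\mathcal D^f$, let $L_f$ be a Lipschitz constant of $S^f$ as in (ii), and let $$\hat d(f,g)=\sup\Big\{\frac{\|S^f_1u-S^g_1u\|_{L^1}}{|u^+-u^-|}\;:\;u=(u^-,u^+)\in\mathcal D^g\text{ a Riemann datum},\ u^-\ne u^+\Big\}\in[0,\infty].$$ Then for all $u\in\mathcal D^g$ and $t\ge0$ $$\|S^f_tu-S^g_tu\|_{L^1}\le L_f\cdot\hat d(f,g)\cdot\int_0^t\mathrm{Tot.Var.}(S^g_su)\,ds ,$$ where the right-hand side is computed in $[0,\infty]$ with $0\cdot\infty=0$. -/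

import Mathlib

open Set Filter Topology MeasureTheory
open scoped NNReal ENNReal

/-- The state space `ℝⁿ` with the Euclidean norm. -/
abbrev State (n : ℕ) : Type := EuclideanSpace ℝ (Fin n)

/-- The `L¹` distance `‖u - w‖_{L¹(ℝ)}`, with values in `[0, ∞]`. -/
noncomputable def lOneDist {n : ℕ} (u w : ℝ → State n) : ℝ≥0∞ :=
  ∫⁻ x, ‖u x - w x‖ₑ

/-- The total variation on the whole line. It is only used for right continuous functions, for
which it agrees with the essential variation. -/
noncomputable def totVar {n : ℕ} (u : ℝ → State n) : ℝ≥0∞ :=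
  eVariationOn u univ

/-- The Riemann datum with left state `ul` and right state `ur`. -/
noncomputable def riemannDatum {n : ℕ} (ul ur : State n) : ℝ → State n :=
  fun x => if x < 0 then ul else ur

/-- `u` is piecewise constant (right continuous representative): there are finitely many points
such that `u` is constant on each of the half-open intervals `[a, b)` that they cut out. -/
def IsPiecewiseConst {n : ℕ} (u : ℝ → State n) : Prop :=
  ∃ J : Finset ℝ, ∀ x y : ℝ, x < y → (∀ z ∈ J, z ∉ Ioc x y) → u x = u y

/-- The flux `f` is hyperbolic on `Ω`: every Jacobian matrix `Df(u)` is diagonalizable with real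
eigenvalues. -/
def IsHyperbolicOn {n : ℕ} (Ω : Set (State n)) (f : State n → State n) : Prop :=
  ∀ u ∈ Ω, ∃ (b : Module.Basis (Fin n) ℝ (State n)) (μ : Fin n → ℝ),
    ∀ i, fderiv ℝ f u (b i) = μ i • b i

/-- The jump from `ul` to `ur` with speed `σ` is an admissible shock or a contact discontinuity:
it satisfies the Rankine-Hugoniot conditions and Liu's entropy condition, that is, `ul` and `ur`
are joined by an arc `γ` of the Hugoniot locus of `ul` along which the speed `s` of the
discontinuity from `ul` to `γ τ` is never smaller than `σ`. -/
def IsAdmissibleJump {n : ℕ} (Ω : Set (State n)) (f : State n → State n)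
    (ul ur : State n) (σ : ℝ) : Prop :=
  f ur - f ul = σ • (ur - ul) ∧
  ∃ (γ : ℝ → State n) (s : ℝ → ℝ),
    ContinuousOn γ (Icc 0 1) ∧ InjOn γ (Icc 0 1) ∧ γ 0 = ul ∧ γ 1 = ur ∧
    ∀ τ ∈ Icc (0 : ℝ) 1, γ τ ∈ Ω ∧ f (γ τ) - f ul = s τ • (γ τ - ul) ∧ σ ≤ s τ

/-- `ω` is the profile of a standard (Lax, Liu) self-similar entropic solution
`(t, x) ↦ ω (x / t)` of the Riemann problem with states `ul`, `ur`, all waves of which have speed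
smaller than `lam` in absolute value: a piecewise smooth function that consists of constant
states and centered rarefaction waves, where `Df(ω) ω' = ξ ω'`, separated by kinks and by
admissible shocks or contact discontinuities. -/
structure IsStandardRiemannSolution {n : ℕ} (Ω : Set (State n)) (f : State n → State n)
    (lam : ℝ) (ul ur : State n) (ω : ℝ → State n) : Prop where
  mem : ∀ ξ, ω ξ ∈ Ω
  rightCont : ∀ ξ, ContinuousWithinAt ω (Ici ξ) ξ
  boundedVariation : BoundedVariationOn ω univ
  left_eq : ∀ ξ, ξ ≤ -lam → ω ξ = ul
  right_eq : ∀ ξ, lam ≤ ξ → ω ξ = ur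
  waves : ∃ J : Finset ℝ,
    (∀ ξ, ξ ∉ J → ∃ ω', HasDerivAt ω ω' ξ ∧ fderiv ℝ f (ω ξ) ω' = ξ • ω') ∧
    (∀ σ ∈ J, ∃ ωl, Tendsto ω (𝓝[<] σ) (𝓝 ωl) ∧
      (ωl = ω σ ∨ IsAdmissibleJump Ω f ωl (ω σ) σ))

/-- `w` is obtained at time `t` from the piecewise constant function `u` by glueing together the
solutions, given by the Riemann solver `R`, of the Riemann problems at the jumps of `u`. -/
def IsRiemannGlueing {n : ℕ} (R : State n → State n → ℝ → State n) (lam : ℝ)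
    (u : ℝ → State n) (t : ℝ) (w : ℝ → State n) : Prop :=
  (∀ ξ, ¬ ContinuousAt u ξ → ∀ x, |x - ξ| ≤ lam * t →
    w x = R (Function.leftLim u ξ) (u ξ) ((x - ξ) / t)) ∧
  (∀ x, (∀ ξ, ¬ ContinuousAt u ξ → lam * t < |x - ξ|) → w x = u x)

/-- Domains of Standard Riemann Semigroups: sets of functions of bounded variation (represented by
their right continuous representatives) with values in `Ω`. -/
structure IsSRSDomain {n : ℕ} (Ω : Set (State n)) (D : Set (ℝ → State n)) : Prop where
  rightCont : ∀ u ∈ D, ∀ x, ContinuousWithinAt u (Ici x) x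
  boundedVariation : ∀ u ∈ D, BoundedVariationOn u univ
  range : ∀ u ∈ D, ∃ K ⊆ Ω, IsCompact K ∧ ∀ x, u x ∈ K
  /-- `D` contains the piecewise constant functions of sufficiently small total variation, locally
  uniformly in `Ω`. -/
  small : ∀ K ⊆ Ω, IsCompact K → ∃ η : ℝ≥0∞, 0 < η ∧ ∀ u : ℝ → State n,
    IsPiecewiseConst u → (∀ x, u x ∈ K) → totVar u ≤ η → u ∈ D
  /-- `D` is closed under sampling: it contains every function that, from left to right, takes
  only values of some `u ∈ D`, in the same order, and is constant near `-∞` and near `+∞`. In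
  particular it contains the Riemann data formed by two values of `u` in their order. -/
  sampling : ∀ u ∈ D, ∀ φ : ℝ → ℝ, Monotone φ → (∀ x, ContinuousWithinAt φ (Ici x) x) →
    (∃ a b : ℝ, (∀ x ≤ a, φ x = φ a) ∧ (∀ x ≥ b, φ x = φ b)) → u ∘ φ ∈ D

/-- `L` is a Lipschitz constant of the semigroup `S` on `D`. -/
def IsLipschitzConst {n : ℕ} (D : Set (ℝ → State n))
    (S : ℝ → (ℝ → State n) → ℝ → State n) (L : ℝ≥0) : Prop :=
  0 < L ∧ ∀ t s : ℝ, 0 ≤ t → 0 ≤ s → ∀ u ∈ D, ∀ w ∈ D,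
    lOneDist (S t u) (S s w) ≤ L * (ENNReal.ofReal |t - s| + lOneDist u w)

/-- `f` belongs to `Hyp(Ω)`, with the Standard Riemann Semigroup `S : [0, ∞) × D → D`. The values
of `S t u` for `t < 0` or `u ∉ D` are irrelevant. -/
structure GeneratesSRS {n : ℕ} (Ω : Set (State n)) (f : State n → State n)
    (D : Set (ℝ → State n)) (S : ℝ → (ℝ → State n) → ℝ → State n) : Prop where
  isOpen : IsOpen Ω
  smooth : ContDiffOn ℝ 1 f Ω
  hyperbolic : IsHyperbolicOn Ω f
  domain : IsSRSDomain Ω D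
  mapsTo : ∀ t, 0 ≤ t → ∀ u ∈ D, S t u ∈ D
  zero : ∀ u ∈ D, S 0 u = u
  add : ∀ t s, 0 ≤ t → 0 ≤ s → ∀ u ∈ D, S t (S s u) = S (t + s) u
  lipschitz : ∃ L : ℝ≥0, IsLipschitzConst D S L
  /-- `R ul ur` is the standard solution of the Riemann problem with states `ul`, `ur`, and `lam`
  bounds the speeds of all waves: `S` has finite speed of propagation `lam`, and on piecewise
  constant data `S` is given by glueing together the standard solutions of the Riemann problems
  at the jumps, for times so small that these do not interact. -/
  riemann : ∃ (R : State n → State n → ℝ → State n) (lam : ℝ), 0 < lam ∧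
    (∀ ul ur, riemannDatum ul ur ∈ D → IsStandardRiemannSolution Ω f lam ul ur (R ul ur)) ∧
    (∀ u ∈ D, IsPiecewiseConst u → ∀ t, 0 < t →
      (∀ ξ ξ', ¬ ContinuousAt u ξ → ¬ ContinuousAt u ξ' → ξ < ξ' → 2 * lam * t < ξ' - ξ) →
      IsRiemannGlueing R lam u t (S t u)) ∧
    (∀ u ∈ D, ∀ w ∈ D, ∀ a b : ℝ, (∀ x ∈ Ioo a b, u x = w x) → ∀ t, 0 ≤ t →
      ∀ x ∈ Ioo (a + lam * t) (b - lam * t), S t u x = S t w x)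

/-- The distance `d̂(f, g)` between the fluxes generating `S` and `T`: the supremum over the
Riemann data in `D` of the `L¹` distance at time `1` divided by the size of the jump. -/
noncomputable def riemannDist {n : ℕ} (D : Set (ℝ → State n))
    (S T : ℝ → (ℝ → State n) → ℝ → State n) : ℝ≥0∞ :=
  ⨆ (ul : State n) (ur : State n) (_ : ul ≠ ur) (_ : riemannDatum ul ur ∈ D),
    lOneDist (S 1 (riemannDatum ul ur)) (T 1 (riemannDatum ul ur)) / ‖ur - ul‖ₑ

/-! The error formula `lOneDist_semigroup_le_lintegral`, applied to the semigroup of `f` along a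
trajectory of `g`, reduces the theorem to an instantaneous bound: for each `v ∈ Dg`, `‖Sf h v - Sg h
v‖ ≤ h (d TV(v) + o(1))` as `h → 0+` (`eventually_lOneDist_semigroup_le`), where `d` is the distance
of the fluxes. For piecewise constant `v` this is glueing plus self-similarity. But glueing is
limited to times below the spacing of the jumps, so it does not pass to an `L¹` limit. The bound is
therefore proved locally, with the variation function `V` of `v` recording how much each piece may
contribute.

Near a point `x₀`, on a window of width of order `h`, `v` is `o(h)`-close in `L¹` to a single jump,
and the definition of `d` gives `d` times the jump of `V` at `x₀`. Closure under sampling puts the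
Riemann data in question into `Dg`.

On an open interval where `V` varies little, freeze a state `u₀`. A small Riemann problem is solved,
up to a small relative error, by the system linearized at `u₀`. Indeed, let `ω` be the profile, `l`
a left eigenvector of `A = Df(u₀)` with eigenvalue `μ`, `W` the difference of the `l`-components of
`ω` and of the linear solution, and `q = l (f ω - A ω)`. The conservation law says `(ξ - μ) dW =
dq`, whence `∫ |W| ≤ TV(q)`. This is small relative to the jump, because `f - A` has a small
Lipschitz constant near `u₀` and `TV(ω)` is at most a constant times the jump. The linear flow maps
step functions to step functions with the same jump vectors, so a second use of the error formula
extends the approximation to all times, even after waves have crossed. The linear flows of `f` and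
`g` differ by at most `d h ∑ ‖r p‖`, by rescaling small Riemann problems. The resulting bound for
step functions does not restrict `h` by the spacing of the jumps, hence it does pass to the limit.

Finite propagation speed localizes these two estimates, and a continuous induction along the line
adds them up. If `d = ∞`, lower semicontinuity of the variation makes the integral positive unless
`u` is constant, and constants are fixed by both semigroups. -/

/-- A right continuous function on the line is Borel measurable. -/
theorem measurable_of_forall_continuousWithinAt_Ici {E : Type*} [PseudoMetricSpace E]
    [MeasurableSpace E] [BorelSpace E] {v : ℝ → E}
    (hv : ∀ x, ContinuousWithinAt v (Ici x) x) : Measurable v := by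
  -- The sampling point is the next grid point strictly to the right of `x`, so right continuity is
  -- enough for convergence.
  have hlt : ∀ (k : ℕ) (x : ℝ), x < (⌊((k : ℝ) + 1) * x⌋ + 1) / ((k : ℝ) + 1) := fun k x => by
    rw [lt_div_iff₀ (by positivity), mul_comm]
    exact Int.lt_floor_add_one _
  refine measurable_of_tendsto_metrizable
    (f := fun (k : ℕ) x => v ((⌊((k : ℝ) + 1) * x⌋ + 1) / ((k : ℝ) + 1))) (fun k => ?_) ?_
  · exact (measurable_from_top (f := fun z : ℤ => v (((z : ℝ) + 1) / ((k : ℝ) + 1)))).comp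
      (Int.measurable_floor.comp (measurable_const_mul ((k : ℝ) + 1)))
  · refine tendsto_pi_nhds.2 fun x => ?_
    refine (hv x).tendsto.comp (tendsto_nhdsWithin_iff.2 ⟨?_, Eventually.of_forall fun k =>
      (hlt k x).le⟩)
    have hub : ∀ k : ℕ, ((⌊((k : ℝ) + 1) * x⌋ + 1) / ((k : ℝ) + 1) : ℝ) ≤ x + 1 / ((k : ℝ) + 1) :=
      fun k => by
        have hk : (0 : ℝ) < k + 1 := by positivity
        rw [div_le_iff₀ hk, add_mul x, one_div, inv_mul_cancel₀ hk.ne', mul_comm x]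
        linarith [Int.floor_le (((k : ℝ) + 1) * x)]
    refine tendsto_of_tendsto_of_tendsto_of_le_of_le tendsto_const_nhds ?_
      (fun k => (hlt k x).le) hub
    simpa using tendsto_const_nhds.add (tendsto_one_div_add_atTop_nhds_zero_nat (𝕜 := ℝ))

theorem lintegral_comp_sub_div (F : ℝ → ℝ≥0∞) (a : ℝ) {h : ℝ} (hh : 0 < h) :
    ∫⁻ x, F ((x - a) / h) = ENNReal.ofReal h * ∫⁻ x, F x := by
  have h1 : ∫⁻ x, F ((x - a) / h) = ∫⁻ x, F (x / h) :=
    lintegral_sub_right_eq_self (fun x => F (x / h)) a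
  rw [h1]
  have h2 := Real.smul_map_volume_mul_left (a := h⁻¹) (inv_ne_zero hh.ne')
  have h3 : Measure.map (h⁻¹ * ·) volume = ENNReal.ofReal h • (volume : Measure ℝ) := by
    rw [Real.map_volume_mul_left (inv_ne_zero hh.ne'), inv_inv, abs_of_pos hh]
  have h4 := (Homeomorph.mulLeft₀ h⁻¹ (inv_ne_zero hh.ne')).measurableEmbedding.lintegral_map
    (μ := volume) F
  simp only [Homeomorph.coe_mulLeft₀] at h4
  rw [h3, lintegral_smul_measure] at h4
  rw [← smul_eq_mul, h4]
  exact lintegral_congr fun x => by rw [div_eq_inv_mul]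

/-! ### The `L¹` distance and the error formula -/

section LOneDist

variable {n : ℕ}

theorem lOneDist_comm (u w : ℝ → State n) : lOneDist u w = lOneDist w u :=
  lintegral_congr fun x => by rw [← enorm_neg, neg_sub]

@[simp] theorem lOneDist_self (u : ℝ → State n) : lOneDist u u = 0 := by
  simp [lOneDist]

theorem setLIntegral_enorm_sub_triangle {u v w : ℝ → State n} (hu : Measurable u)
    (hv : Measurable v) (s : Set ℝ) :
    ∫⁻ x in s, ‖u x - w x‖ₑ ≤ (∫⁻ x in s, ‖u x - v x‖ₑ) + ∫⁻ x in s, ‖v x - w x‖ₑ := by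
  have hm : Measurable fun x => ‖u x - v x‖ₑ := (hu.sub hv).enorm
  rw [← lintegral_add_left hm]
  exact lintegral_mono fun x => by
    rw [← sub_add_sub_cancel (u x) (v x) (w x)]; exact enorm_add_le _ _

theorem lOneDist_triangle {u v : ℝ → State n} (hu : Measurable u) (hv : Measurable v)
    (w : ℝ → State n) : lOneDist u w ≤ lOneDist u v + lOneDist v w := by
  simpa [lOneDist] using setLIntegral_enorm_sub_triangle (w := w) hu hv univ

theorem setLIntegral_le_lOneDist (u w : ℝ → State n) (s : Set ℝ) :
    ∫⁻ x in s, ‖u x - w x‖ₑ ≤ lOneDist u w :=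
  setLIntegral_le_lintegral _ _

theorem IsSRSDomain.measurable {Ω : Set (State n)} {D : Set (ℝ → State n)}
    (hD : IsSRSDomain Ω D) {u : ℝ → State n} (hu : u ∈ D) : Measurable u :=
  measurable_of_forall_continuousWithinAt_Ici (hD.rightCont u hu)

/-- **Error formula**: the distance of a Lipschitz curve from the trajectory of a Lipschitz
semigroup is bounded by the integral of the instantaneous error. -/
theorem lOneDist_semigroup_le_lintegral {D : Set (ℝ → State n)}
    {S : ℝ → (ℝ → State n) → ℝ → State n} {L : ℝ≥0} (hmeas : ∀ u ∈ D, Measurable u)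
    (hmaps : ∀ t, 0 ≤ t → ∀ u ∈ D, S t u ∈ D) (hzero : ∀ u ∈ D, S 0 u = u)
    (hadd : ∀ t s, 0 ≤ t → 0 ≤ s → ∀ u ∈ D, S t (S s u) = S (t + s) u)
    (hL : IsLipschitzConst D S L) {w : ℝ → ℝ → State n} {T : ℝ} (hT : 0 ≤ T)
    (hw : ∀ s ∈ Icc 0 T, w s ∈ D) (C : ℝ≥0)
    (hC : ∀ s ∈ Icc 0 T, ∀ r ∈ Icc 0 T, lOneDist (w s) (w r) ≤ C * ENNReal.ofReal |s - r|)
    (G : ℝ → ℝ≥0∞)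
    (hG : ∀ s ∈ Ico 0 T, ∀ κ : ℝ, 0 < κ → ∀ᶠ θ in 𝓝[>] (0 : ℝ),
      lOneDist (w (s + θ)) (S θ (w s)) ≤ ENNReal.ofReal θ * (G s + ENNReal.ofReal κ)) :
    lOneDist (w T) (S T (w 0)) ≤ L * ∫⁻ s in Ioc 0 T, G s := by
  have h0 : (0 : ℝ) ∈ Icc 0 T := ⟨le_rfl, hT⟩
  have hTm : T ∈ Icc 0 T := ⟨hT, le_rfl⟩
  have hSm : ∀ t, 0 ≤ t → ∀ u ∈ D, Measurable (S t u) := fun t ht u hu => hmeas _ (hmaps t ht u hu)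
  -- Everything is transported to the final time: `φ 0 = 0`, `φ T` is the distance sought, and `φ`
  -- is Lipschitz, hence the integral of its derivative.
  set φ : ℝ → ℝ≥0∞ := fun s => lOneDist (S (T - s) (w s)) (S T (w 0)) with hφ
  have hstep : ∀ s ∈ Icc 0 T, ∀ r ∈ Icc 0 T, lOneDist (S (T - s) (w s)) (S (T - r) (w r))
      ≤ ENNReal.ofReal (L * (1 + C) * |s - r|) := by
    intro s hs r hr
    refine (hL.2 _ _ (by linarith [hs.2]) (by linarith [hr.2]) _ (hw s hs) _ (hw r hr)).trans ?_
    have h1 : |T - s - (T - r)| = |s - r| := by rw [abs_sub_comm]; congr 1; ring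
    rw [h1, mul_assoc, ENNReal.ofReal_mul (by positivity), ENNReal.ofReal_coe_nnreal, add_mul,
      one_mul, ENNReal.ofReal_add (abs_nonneg _) (by positivity),
      ENNReal.ofReal_mul (by positivity), ENNReal.ofReal_coe_nnreal]
    gcongr
    exact hC s hs r hr
  have hφ0 : φ 0 = 0 := by simp [hφ]
  have hφT : φ T = lOneDist (w T) (S T (w 0)) := by simp [hφ, hzero _ (hw T hTm)]
  have hφle : ∀ s ∈ Icc 0 T, ∀ r ∈ Icc 0 T,
      φ s ≤ lOneDist (S (T - s) (w s)) (S (T - r) (w r)) + φ r := fun s hs r hr =>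
    lOneDist_triangle (hSm _ (by linarith [hs.2]) _ (hw s hs))
      (hSm _ (by linarith [hr.2]) _ (hw r hr)) _
  have hfin : ∀ s ∈ Icc 0 T, φ s ≠ ∞ := fun s hs => by
    refine ((hφle s hs 0 h0).trans_lt ?_).ne
    rw [hφ0, add_zero]
    exact (hstep s hs 0 h0).trans_lt ENNReal.ofReal_lt_top
  set Φ : ℝ → ℝ := fun s => (φ s).toReal with hΦ
  have hΦle : ∀ s ∈ Icc 0 T, ∀ r ∈ Icc 0 T,
      ENNReal.ofReal (Φ s - Φ r) ≤ lOneDist (S (T - s) (w s)) (S (T - r) (w r)) := by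
    intro s hs r hr
    rw [ENNReal.ofReal_sub _ ENNReal.toReal_nonneg, ENNReal.ofReal_toReal (hfin s hs),
      ENNReal.ofReal_toReal (hfin r hr), tsub_le_iff_right]
    exact hφle s hs r hr
  have hlip : LipschitzOnWith (L * (1 + C)) Φ (Icc 0 T) := by
    refine LipschitzOnWith.of_le_add_mul _ fun s hs r hr => ?_
    have := (ENNReal.ofReal_le_ofReal_iff (by positivity)).1
      ((hΦle s hs r hr).trans (hstep s hs r hr))
    rw [Real.dist_eq]
    push_cast
    linarith
  have hac : AbsolutelyContinuousOnInterval Φ 0 T := by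
    apply LipschitzOnWith.absolutelyContinuousOnInterval (K := L * (1 + C))
    rwa [uIcc_of_le hT]
  have hftc := hac.integral_deriv_eq_sub
  have hderiv : ∀ᵐ s ∂(volume.restrict (Ioc 0 T)), ENNReal.ofReal (deriv Φ s) ≤ L * G s := by
    rw [← Measure.restrict_congr_set Ioo_ae_eq_Ioc, ae_restrict_iff' measurableSet_Ioo]
    filter_upwards [hlip.ae_differentiableWithinAt_of_mem_real] with s hs hsI
    have hd : HasDerivAt Φ (deriv Φ s) s :=
      ((hs (Ioo_subset_Icc_self hsI)).differentiableAt (Icc_mem_nhds hsI.1 hsI.2)).hasDerivAt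
    have hκ : ∀ κ : ℝ, 0 < κ → ENNReal.ofReal (deriv Φ s) ≤ L * (G s + ENNReal.ofReal κ) := by
      intro κ hκ
      have ht := hd.tendsto_slope_zero_right
      refine le_of_tendsto (ENNReal.tendsto_ofReal ht) ?_
      have hsmall : ∀ᶠ θ in 𝓝[>] (0 : ℝ), θ < T - s :=
        nhdsWithin_le_nhds (Iio_mem_nhds (by linarith [hsI.2]))
      filter_upwards [hG s ⟨hsI.1.le, hsI.2⟩ κ hκ, self_mem_nhdsWithin, hsmall] with θ h1 h2 h3
      have h2 : 0 < θ := h2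
      have hsθ : s + θ ∈ Icc 0 T := ⟨by linarith [hsI.1], by linarith⟩
      have hsI' := Ioo_subset_Icc_self hsI
      have h4 : ENNReal.ofReal (Φ (s + θ) - Φ s)
          ≤ L * (ENNReal.ofReal θ * (G s + ENNReal.ofReal κ)) := by
        refine (hΦle _ hsθ _ hsI').trans ?_
        -- Between `s` and `s + θ` only the local error arises; transporting it to time `T` costs
        -- the factor `L` once.
        have h5 : S (T - s) (w s) = S (T - (s + θ)) (S θ (w s)) := by
          rw [hadd _ _ (by linarith) h2.le _ (hw s hsI')]; congr 1; ring
        rw [h5]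
        refine (hL.2 _ _ (by linarith) (by linarith) _ (hw _ hsθ) _
          (hmaps _ h2.le _ (hw s hsI'))).trans ?_
        simp only [sub_self, abs_zero, ENNReal.ofReal_zero, zero_add]
        gcongr
      rw [smul_eq_mul, ENNReal.ofReal_mul (by positivity)]
      calc ENNReal.ofReal θ⁻¹ * ENNReal.ofReal (Φ (s + θ) - Φ s)
          ≤ ENNReal.ofReal θ⁻¹ * (L * (ENNReal.ofReal θ * (G s + ENNReal.ofReal κ))) := by
            gcongr
        _ = (ENNReal.ofReal θ⁻¹ * ENNReal.ofReal θ) * (L * (G s + ENNReal.ofReal κ)) := by ring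
        _ = L * (G s + ENNReal.ofReal κ) := by
            rw [← ENNReal.ofReal_mul (by positivity), inv_mul_cancel₀ h2.ne', ENNReal.ofReal_one,
              one_mul]
    have hlim : Tendsto (fun κ : ℝ => (L : ℝ≥0∞) * (G s + ENNReal.ofReal κ)) (𝓝[>] 0)
        (𝓝 (L * (G s + ENNReal.ofReal 0))) :=
      (ENNReal.Tendsto.const_mul (tendsto_const_nhds.add (ENNReal.tendsto_ofReal tendsto_id))
        (Or.inr ENNReal.coe_ne_top)).mono_left nhdsWithin_le_nhds
    rw [ENNReal.ofReal_zero, add_zero] at hlim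
    exact ge_of_tendsto hlim (eventually_mem_nhdsWithin.mono fun κ hk => hκ κ hk)
  have hint : Integrable (deriv Φ) (volume.restrict (Ioc 0 T)) :=
    (intervalIntegrable_iff_integrableOn_Ioc_of_le hT).1 hac.intervalIntegrable_deriv
  rw [← hφT, ← ENNReal.ofReal_toReal (hfin T hTm)]
  have h1 : (φ T).toReal = ∫ s in Ioc 0 T, deriv Φ s := by
    rw [← intervalIntegral.integral_of_le hT, hftc]
    simp [hΦ, hφ0]
  rw [h1]
  calc ENNReal.ofReal (∫ s in Ioc 0 T, deriv Φ s)
      ≤ ∫⁻ s in Ioc 0 T, ENNReal.ofReal (deriv Φ s) := by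
        rw [integral_eq_lintegral_pos_part_sub_lintegral_neg_part hint]
        refine (ENNReal.ofReal_le_ofReal (sub_le_self _ ENNReal.toReal_nonneg)).trans ?_
        exact ENNReal.ofReal_toReal_le
    _ ≤ ∫⁻ s in Ioc 0 T, L * G s := lintegral_mono_ae hderiv
    _ = L * ∫⁻ s in Ioc 0 T, G s := lintegral_const_mul' _ _ ENNReal.coe_ne_top

end LOneDist

theorem eVariationOn_univ_le_of_edist_le {E : Type*} [PseudoEMetricSpace E] {v : ℝ → E}
    {N : ℝ → ℝ} {C : ℝ} (hN : ∀ a b, a ≤ b → edist (v b) (v a) ≤ ENNReal.ofReal (N b - N a))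
    (hmono : Monotone N) (hC : ∀ a b, N b - N a ≤ C) :
    eVariationOn v univ ≤ ENNReal.ofReal C := by
  refine iSup_le fun p => ?_
  obtain ⟨k, u, hu, -⟩ := p
  calc ∑ i ∈ Finset.range k, edist (v (u (i + 1))) (v (u i))
      ≤ ∑ i ∈ Finset.range k, ENNReal.ofReal (N (u (i + 1)) - N (u i)) :=
        Finset.sum_le_sum fun i _ => hN _ _ (hu i.le_succ)
    _ = ENNReal.ofReal (N (u k) - N (u 0)) := by
        rw [← ENNReal.ofReal_sum_of_nonneg fun i _ => sub_nonneg.2 (hmono (hu i.le_succ)),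
          Finset.sum_range_sub fun i => N (u i)]
    _ ≤ ENNReal.ofReal C := ENNReal.ofReal_le_ofReal (hC _ _)

/-! ### Step functions with possibly coinciding jump points -/

section StepFun

variable {n : ℕ} {ι : Type} [Fintype ι]

/-- The step function with value `c` near `-∞` and jumps `r p` at the points `x p`. -/
noncomputable def stepFun (c : State n) (x : ι → ℝ) (r : ι → State n) : ℝ → State n :=
  fun y => c + ∑ p, if x p ≤ y then r p else 0

/-- The left limit of `stepFun c x r`. -/
noncomputable def stepFunLeft (c : State n) (x : ι → ℝ) (r : ι → State n) : ℝ → State n :=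
  fun y => c + ∑ p, if x p < y then r p else 0

variable {c : State n} {x : ι → ℝ} {r : ι → State n}

theorem stepFun_eq_of_forall_notMem_Ioc {y z : ℝ} (hyz : y ≤ z) (h : ∀ p, x p ∉ Ioc y z) :
    stepFun c x r z = stepFun c x r y := by
  unfold stepFun
  congr 1
  refine Finset.sum_congr rfl fun p _ => ?_
  have : x p ≤ z ↔ x p ≤ y :=
    ⟨fun h1 => not_lt.1 fun h2 => h p ⟨h2, h1⟩, fun h1 => h1.trans hyz⟩
  simp only [this]

theorem stepFun_eq_left {y z : ℝ} (hyz : y < z) (h : ∀ p, x p ∉ Ioo y z) :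
    stepFun c x r y = stepFunLeft c x r z := by
  unfold stepFun stepFunLeft
  congr 1
  refine Finset.sum_congr rfl fun p _ => ?_
  have : x p < z ↔ x p ≤ y :=
    ⟨fun h1 => not_lt.1 fun h2 => h p ⟨h2, h1⟩, fun h1 => h1.trans_lt hyz⟩
  simp only [this]

theorem isPiecewiseConst_stepFun : IsPiecewiseConst (stepFun c x r) :=
  ⟨Finset.univ.image x, fun _ _ hyz h => (stepFun_eq_of_forall_notMem_Ioc hyz.le fun p =>
    h (x p) (Finset.mem_image_of_mem x (Finset.mem_univ p))).symm⟩

theorem eventually_forall_notMem_Ioc (x : ι → ℝ) (y : ℝ) :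
    ∀ᶠ z in 𝓝[≥] y, ∀ p, x p ∉ Ioc y z := by
  refine eventually_all.2 fun p => ?_
  rcases le_or_gt (x p) y with h | h
  · exact Eventually.of_forall fun z hz => hz.1.not_ge h
  · filter_upwards [nhdsWithin_le_nhds (Iio_mem_nhds h)] with z hz h2 using (h2.2.trans_lt hz).false

theorem eventually_forall_notMem_Ioo (x : ι → ℝ) (y : ℝ) :
    ∀ᶠ z in 𝓝[<] y, ∀ p, x p ∉ Ioo z y := by
  refine eventually_all.2 fun p => ?_
  rcases le_or_gt y (x p) with h | h
  · exact Eventually.of_forall fun z hz => hz.2.not_ge h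
  · filter_upwards [nhdsWithin_le_nhds (Ioi_mem_nhds h)] with z hz h2 using (h2.1.trans hz).false

theorem tendsto_stepFun_left (y : ℝ) :
    Tendsto (stepFun c x r) (𝓝[<] y) (𝓝 (stepFunLeft c x r y)) := by
  refine tendsto_const_nhds.congr' ?_
  filter_upwards [eventually_forall_notMem_Ioo x y, self_mem_nhdsWithin] with z hz hzy
  exact (stepFun_eq_left hzy hz).symm

theorem continuousWithinAt_stepFun (y : ℝ) : ContinuousWithinAt (stepFun c x r) (Ici y) y := by
  refine tendsto_const_nhds.congr' ?_
  filter_upwards [eventually_forall_notMem_Ioc x y, self_mem_nhdsWithin] with z hz hzy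
  exact (stepFun_eq_of_forall_notMem_Ioc hzy hz).symm

theorem leftLim_stepFun (y : ℝ) :
    Function.leftLim (stepFun c x r) y = stepFunLeft c x r y :=
  leftLim_eq_of_tendsto (tendsto_stepFun_left y)

theorem continuousAt_stepFun_iff {y : ℝ} :
    ContinuousAt (stepFun c x r) y ↔ stepFunLeft c x r y = stepFun c x r y := by
  constructor
  · intro h
    exact tendsto_nhds_unique (tendsto_stepFun_left y) (h.tendsto.mono_left nhdsWithin_le_nhds)
  · intro h
    refine continuousAt_iff_continuous_left'_right'.2 ⟨?_, ?_⟩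
    · have := tendsto_stepFun_left (c := c) (x := x) (r := r) y
      rwa [h] at this
    · exact (continuousWithinAt_stepFun y).mono Ioi_subset_Ici_self

theorem stepFunLeft_eq_of_forall_ne {y : ℝ} (h : ∀ p, x p ≠ y) :
    stepFunLeft c x r y = stepFun c x r y := by
  unfold stepFun stepFunLeft
  congr 1
  exact Finset.sum_congr rfl fun p _ => by simp only [lt_iff_le_and_ne, h p, ne_eq,
    not_false_iff, and_true]

theorem stepFun_sub_stepFunLeft (y : ℝ) :
    stepFun c x r y - stepFunLeft c x r y = ∑ p with x p = y, r p := by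
  unfold stepFun stepFunLeft
  rw [add_sub_add_left_eq_sub, ← Finset.sum_sub_distrib, Finset.sum_filter]
  refine Finset.sum_congr rfl fun p _ => ?_
  rcases lt_trichotomy (x p) y with h | h | h
  · simp [h, h.le, h.ne]
  · simp [h]
  · simp [h.not_gt, h.not_ge, h.ne']

theorem norm_stepFun_sub_le (y : ℝ) : ‖stepFun c x r y - c‖ ≤ ∑ p, ‖r p‖ := by
  unfold stepFun
  rw [add_sub_cancel_left]
  refine (norm_sum_le _ _).trans (Finset.sum_le_sum fun p _ => ?_)
  split_ifs <;> simp

theorem norm_stepFunLeft_sub_le (y : ℝ) : ‖stepFunLeft c x r y - c‖ ≤ ∑ p, ‖r p‖ := by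
  unfold stepFunLeft
  rw [add_sub_cancel_left]
  refine (norm_sum_le _ _).trans (Finset.sum_le_sum fun p _ => ?_)
  split_ifs <;> simp

theorem totVar_stepFun_le : totVar (stepFun c x r) ≤ ENNReal.ofReal (∑ p, ‖r p‖) := by
  have hind : ∀ a b p, a ≤ b →
      ‖(if x p ≤ b then r p else 0) - (if x p ≤ a then r p else 0)‖
        ≤ (if x p ≤ b then ‖r p‖ else 0) - (if x p ≤ a then ‖r p‖ else 0) := by
    intro a b p hab
    by_cases h1 : x p ≤ a
    · simp [h1, h1.trans hab]
    · by_cases h2 : x p ≤ b <;> simp [h1, h2]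
  refine eVariationOn_univ_le_of_edist_le
    (N := fun y => ∑ p, if x p ≤ y then ‖r p‖ else 0) (fun a b hab => ?_) (fun a b hab => ?_)
    fun a b => ?_
  · rw [edist_dist, dist_eq_norm]
    refine ENNReal.ofReal_le_ofReal ?_
    unfold stepFun
    rw [add_sub_add_left_eq_sub, ← Finset.sum_sub_distrib, ← Finset.sum_sub_distrib]
    exact (norm_sum_le _ _).trans (Finset.sum_le_sum fun p _ => hind a b p hab)
  · refine sub_nonneg.1 ?_
    rw [← Finset.sum_sub_distrib]
    exact Finset.sum_nonneg fun p _ => (norm_nonneg _).trans (hind a b p hab)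
  · rw [← Finset.sum_sub_distrib]
    refine Finset.sum_le_sum fun p _ => ?_
    have := norm_nonneg (r p)
    split_ifs <;> linarith

theorem measurable_stepFun : Measurable (stepFun c x r) :=
  measurable_of_forall_continuousWithinAt_Ici continuousWithinAt_stepFun

theorem riemannDatum_eq_stepFun (ul ur : State n) :
    riemannDatum ul ur = stepFun (ι := Unit) ul (fun _ => 0) (fun _ => ur - ul) := by
  funext y
  by_cases h : y < 0
  · simp [riemannDatum, stepFun, h, h.not_ge]
  · simp [riemannDatum, stepFun, h, not_lt.1 h]

end StepFun

/-! ### Membership in the domain, glueing and propagation speed -/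

section Glueing

variable {n : ℕ} {Ω : Set (State n)} {f : State n → State n} {D : Set (ℝ → State n)}
  {S : ℝ → (ℝ → State n) → ℝ → State n}

/-- Step functions with small jumps near a compact set lie in the domain. -/
theorem IsSRSDomain.exists_stepFun_mem (hD : IsSRSDomain Ω D) (hΩ : IsOpen Ω) {u₀ : State n}
    (hu₀ : u₀ ∈ Ω) : ∃ δ > 0, ∀ {ι : Type} [Fintype ι] (c : State n) (x : ι → ℝ)
      (r : ι → State n), ‖c - u₀‖ ≤ δ → ∑ p, ‖r p‖ ≤ δ → stepFun c x r ∈ D := by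
  obtain ⟨ρ, hρ, hball⟩ := Metric.isOpen_iff.1 hΩ u₀ hu₀
  obtain ⟨η, hη, hsmall⟩ := hD.small (Metric.closedBall u₀ (ρ / 2))
    ((Metric.closedBall_subset_ball (by linarith)).trans hball) (isCompact_closedBall _ _)
  obtain ⟨η', hη', hη''⟩ := ENNReal.lt_iff_exists_nnreal_btwn.1 hη
  have hη'0 : (0 : ℝ) < η' := by exact_mod_cast hη'
  -- `ρ / 4` for the offset of `c` and `ρ / 4` for the jumps keep all values in the ball of radius
  -- `ρ / 2`; `η'` is a finite replacement for `η`, which may be `∞`.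
  refine ⟨min η' (ρ / 4), by positivity, fun c x r hc hr => hsmall _ isPiecewiseConst_stepFun
    (fun y => ?_) ?_⟩
  · rw [Metric.mem_closedBall, dist_eq_norm, ← sub_add_sub_cancel _ c]
    refine (norm_add_le _ _).trans ?_
    have h1 := norm_stepFun_sub_le (c := c) (x := x) (r := r) y
    have h2 := min_le_right (η' : ℝ) (ρ / 4)
    linarith
  · refine totVar_stepFun_le.trans
      ((ENNReal.ofReal_le_ofReal (hr.trans (min_le_left _ _))).trans ?_)
    rw [ENNReal.ofReal_coe_nnreal]
    exact hη''.le

/-- Two values of `u ∈ D`, in their order, form a Riemann datum in `D`. -/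
theorem IsSRSDomain.jump_mem (hD : IsSRSDomain Ω D) {u : ℝ → State n} (hu : u ∈ D) {a b : ℝ}
    (hab : a ≤ b) (x₀ : ℝ) : (fun x => if x < x₀ then u a else u b) ∈ D := by
  have h := hD.sampling u hu (fun x => if x < x₀ then a else b) ?_ ?_ ?_
  · convert h using 1
    funext x
    by_cases hx : x < x₀ <;> simp [hx]
  · intro x y hxy
    by_cases hy : y < x₀
    · simp [hy, hxy.trans_lt hy]
    · by_cases hx : x < x₀ <;> simp [hx, hy, hab]
  · intro x
    rcases lt_or_ge x x₀ with hx | hx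
    · refine ((continuousAt_const (y := a)).congr ?_).continuousWithinAt
      filter_upwards [Iio_mem_nhds hx] with y hy
      simp [mem_Iio.1 hy]
    · refine (continuousWithinAt_const (b := b)).congr (fun y hy => ?_) ?_
      · simp [hx.trans (mem_Ici.1 hy)]
      · simp [hx]
  · refine ⟨x₀ - 1, x₀, fun x hx => ?_, fun x hx => ?_⟩
    · simp [show x < x₀ by linarith]
    · simp [hx]

theorem IsSRSDomain.riemannDatum_mem (hD : IsSRSDomain Ω D) {u : ℝ → State n} (hu : u ∈ D)
    {a b : ℝ} (hab : a ≤ b) : riemannDatum (u a) (u b) ∈ D :=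
  hD.jump_mem hu hab 0

/-- `lam` bounds the wave speeds of the semigroup `S`. Here `S 1` applied to Riemann data serves
as Riemann solver. -/
structure IsSpeedBound (Ω : Set (State n)) (f : State n → State n) (D : Set (ℝ → State n))
    (S : ℝ → (ℝ → State n) → ℝ → State n) (lam : ℝ) : Prop where
  pos : 0 < lam
  standard : ∀ ul ur, riemannDatum ul ur ∈ D →
    IsStandardRiemannSolution Ω f lam ul ur (S 1 (riemannDatum ul ur))
  near_jump : ∀ {ι : Type} [Fintype ι] {c : State n} {x : ι → ℝ} {r : ι → State n},
    stepFun c x r ∈ D → ∀ {t : ℝ}, 0 < t → (∀ p q, x p < x q → 2 * lam * t < x q - x p) →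
    ∀ p y, |y - x p| ≤ lam * t →
      riemannDatum (stepFunLeft c x r (x p)) (stepFun c x r (x p)) ∈ D ∧
      S t (stepFun c x r) y =
        S 1 (riemannDatum (stepFunLeft c x r (x p)) (stepFun c x r (x p))) ((y - x p) / t)
  off_jumps : ∀ {ι : Type} [Fintype ι] {c : State n} {x : ι → ℝ} {r : ι → State n},
    stepFun c x r ∈ D → ∀ {t : ℝ}, 0 < t → (∀ p q, x p < x q → 2 * lam * t < x q - x p) →
    ∀ y, (∀ p, lam * t < |y - x p|) → S t (stepFun c x r) y = stepFun c x r y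
  propagation : ∀ u ∈ D, ∀ w ∈ D, ∀ a b : ℝ, (∀ x ∈ Ioo a b, u x = w x) → ∀ t, 0 ≤ t →
    ∀ x ∈ Ioo (a + lam * t) (b - lam * t), S t u x = S t w x

/-- Enlarging the speed bound is harmless: separation becomes more restrictive, and between the
narrow and the wide cone the solution still has its outer constant states. This freedom gives a
common bound for `f` and `g` and makes room for the eigenvalues of the linearized system. Points `x
p` where the jumps cancel are admitted; there the Riemann solution is constant. -/
theorem GeneratesSRS.exists_isSpeedBound (hf : GeneratesSRS Ω f D S) :
    ∃ lam : ℝ, ∀ Λ, lam ≤ Λ → IsSpeedBound Ω f D S Λ := by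
  obtain ⟨R, lam, hlam, hR, hglue, hspeed⟩ := hf.riemann
  have hbase : ∀ {ι : Type} [Fintype ι] (c : State n) (x : ι → ℝ) (r : ι → State n),
      stepFun c x r ∈ D → ∀ t, 0 < t → (∀ p q, x p < x q → 2 * lam * t < x q - x p) →
      IsRiemannGlueing R lam (stepFun c x r) t (S t (stepFun c x r)) := by
    intro ι _ c x r hu t ht hsep
    refine hglue _ hu isPiecewiseConst_stepFun t ht fun ξ ξ' h1 h2 hlt => ?_
    have key : ∀ y, ¬ ContinuousAt (stepFun c x r) y → ∃ p, x p = y := fun y hy => by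
      by_contra! h
      exact hy (continuousAt_stepFun_iff.2 (stepFunLeft_eq_of_forall_ne h))
    obtain ⟨p, rfl⟩ := key ξ h1
    obtain ⟨q, rfl⟩ := key ξ' h2
    exact hsep p q hlt
  have hconst : ∀ ul, riemannDatum ul ul ∈ D → S 1 (riemannDatum ul ul) = fun _ => ul := by
    intro ul h
    rw [riemannDatum_eq_stepFun] at h ⊢
    have hg := hbase _ _ _ h 1 one_pos fun p q hpq => absurd hpq (lt_irrefl _)
    funext y
    rw [hg.2 y fun ξ hξ => absurd (continuousAt_stepFun_iff.2 ?_) hξ]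
    · simp [stepFun]
    · simp [stepFun, stepFunLeft]
  have hsol : ∀ ul ur, ul ≠ ur → riemannDatum ul ur ∈ D →
      S 1 (riemannDatum ul ur) = R ul ur := by
    intro ul ur hne h
    have hstd := hR ul ur h
    rw [riemannDatum_eq_stepFun] at h ⊢
    have hg := hbase _ _ _ h 1 one_pos fun p q hpq => absurd hpq (lt_irrefl _)
    have hl : stepFunLeft (ι := Unit) ul (fun _ => 0) (fun _ => ur - ul) 0 = ul := by
      simp [stepFunLeft]
    have hr : stepFun (ι := Unit) ul (fun _ => 0) (fun _ => ur - ul) 0 = ur := by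
      simp [stepFun]
    funext y
    rcases le_or_gt |y| lam with hy | hy
    · have := hg.1 0 (fun hc => hne ?_) y (by simpa using hy)
      · rw [this, leftLim_stepFun, hl, hr]; simp
      · rw [continuousAt_stepFun_iff, hl, hr] at hc; exact hc
    · rw [hg.2 y fun ξ hξ => ?_]
      · rcases lt_or_ge y 0 with h0 | h0
        · rw [hstd.left_eq y (by rw [abs_of_neg h0] at hy; linarith)]
          simp [stepFun, h0.not_ge]
        · rw [hstd.right_eq y (by rw [abs_of_nonneg h0] at hy; linarith)]
          simp [stepFun, h0]
      · have : ξ = 0 := by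
          by_contra h0
          exact hξ (continuousAt_stepFun_iff.2 (stepFunLeft_eq_of_forall_ne fun _ => Ne.symm h0))
        simpa [this] using hy
  have hstandard : ∀ ul ur, riemannDatum ul ur ∈ D →
      IsStandardRiemannSolution Ω f lam ul ur (S 1 (riemannDatum ul ur)) := by
    intro ul ur h
    by_cases hne : ul = ur
    · subst hne
      rw [hconst ul h]
      obtain ⟨K, hKΩ, -, hK⟩ := hf.domain.range _ h
      have hul : ul ∈ Ω := hKΩ (by simpa [riemannDatum] using hK 0)
      exact ⟨fun _ => hul, fun _ => continuousWithinAt_const,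
        by simpa using (hf.domain.boundedVariation _ (hconst ul h ▸ hf.mapsTo 1 zero_le_one _ h)),
        fun _ _ => rfl, fun _ _ => rfl,
        ∅, fun ξ _ => ⟨0, hasDerivAt_const ξ ul, by simp⟩, by simp⟩
    · rw [hsol ul ur hne h]
      exact hR ul ur h
  have hloc : ∀ Λ, lam ≤ Λ → ∀ {ι : Type} [Fintype ι] {c : State n} {x : ι → ℝ} {r : ι → State n},
      stepFun c x r ∈ D → ∀ {t : ℝ}, 0 < t → (∀ p q, x p < x q → 2 * Λ * t < x q - x p) →
      (∀ p y, |y - x p| ≤ Λ * t →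
        riemannDatum (stepFunLeft c x r (x p)) (stepFun c x r (x p)) ∈ D ∧
        S t (stepFun c x r) y = S 1 (riemannDatum (stepFunLeft c x r (x p))
          (stepFun c x r (x p))) ((y - x p) / t)) ∧
      (∀ y, (∀ p, Λ * t < |y - x p|) → S t (stepFun c x r) y = stepFun c x r y) := by
    intro Λ hΛ ι _ c x r hu t ht hsep
    have hΛ0 : 0 < Λ := hlam.trans_le hΛ
    have hlt : lam * t ≤ Λ * t := by gcongr
    have hg := hbase c x r hu t ht fun p q hpq => lt_of_le_of_lt (by nlinarith) (hsep p q hpq)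
    have hdisc : ∀ y, (∀ p, x p ∈ {ξ | ¬ ContinuousAt (stepFun c x r) ξ} → lam * t < |y - x p|) →
        S t (stepFun c x r) y = stepFun c x r y := by
      intro y hy
      refine hg.2 y fun ξ hξ => ?_
      by_cases h : ∃ p, x p = ξ
      · obtain ⟨p, rfl⟩ := h
        exact hy p hξ
      · exact absurd (continuousAt_stepFun_iff.2
          (stepFunLeft_eq_of_forall_ne (not_exists.1 h))) hξ
    refine ⟨fun p y hy => ?_, fun y hy => hdisc y fun p _ => hlt.trans_lt (hy p)⟩
    obtain ⟨ul, hul⟩ : ∃ ul, stepFunLeft c x r (x p) = ul := ⟨_, rfl⟩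
    obtain ⟨ur, hur⟩ : ∃ ur, stepFun c x r (x p) = ur := ⟨_, rfl⟩
    rw [hul, hur]
    -- By separation, no other jump position meets this interval, so only two states occur in it;
    -- sampling then provides the Riemann datum.
    have hval : ∀ y, |y - x p| ≤ Λ * t → stepFun c x r y = if y < x p then ul else ur := by
      intro y hy
      rw [abs_le] at hy
      split_ifs with h
      · rw [← hul]
        refine stepFun_eq_left h fun q hq => ?_
        have := hsep q p hq.2
        linarith [hq.1]
      · rw [← hur]
        refine stepFun_eq_of_forall_notMem_Ioc (not_lt.1 h) fun q hq => ?_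
        have := hsep p q hq.1
        linarith [hq.2, mul_pos hΛ0 ht]
    have hmem : riemannDatum ul ur ∈ D := by
      have h1 := hval (x p - Λ * t) (by simp [abs_of_pos (mul_pos hΛ0 ht)])
      rw [if_pos (by linarith [mul_pos hΛ0 ht])] at h1
      rw [← h1, ← hur]
      exact hf.domain.riemannDatum_mem hu (by linarith [mul_pos hΛ0 ht])
    refine ⟨hmem, ?_⟩
    have hoth : ∀ q, x q ≠ x p → lam * t < |y - x q| := by
      intro q hq
      rw [abs_le] at hy
      rcases lt_or_gt_of_ne hq with h | h
      · have := hsep q p h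
        exact lt_of_lt_of_le (by linarith) (le_abs_self _)
      · have := hsep p q h
        exact lt_of_lt_of_le (by linarith) (neg_le_abs _)
    by_cases hne : ul = ur
    · subst hne
      rw [hconst ul hmem, hdisc y fun q hq => hoth q fun he => ?_, hval y hy, ite_self]
      rw [he] at hq
      exact hq (continuousAt_stepFun_iff.2 (by rw [hul, hur]))
    · rw [hsol ul ur hne hmem]
      rcases le_or_gt |y - x p| (lam * t) with hy' | hy'
      · rw [hg.1 (x p) (fun hc => hne ?_) y hy', leftLim_stepFun, hul, hur]
        rw [continuousAt_stepFun_iff, hul, hur] at hc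
        exact hc
      · have hstd := hR ul ur hmem
        rw [hdisc y fun q _ => ?_, hval y hy]
        · split_ifs with h
          · rw [hstd.left_eq _ ?_]
            rw [div_le_iff₀ ht]
            rw [abs_of_neg (by linarith)] at hy'
            linarith
          · rw [hstd.right_eq _ ?_]
            rw [le_div_iff₀ ht]
            rw [abs_of_nonneg (by linarith)] at hy'
            linarith
        · by_cases he : x q = x p
          · rwa [he]
          · exact hoth q he
  refine ⟨lam, fun Λ hΛ => ⟨hlam.trans_le hΛ, fun ul ur h => ?_,
    fun hu _ ht hsep => (hloc Λ hΛ hu ht hsep).1, fun hu _ ht hsep => (hloc Λ hΛ hu ht hsep).2,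
    fun u hu w hw a b h t ht y hy => ?_⟩⟩
  · exact { hstandard ul ur h with
      left_eq := fun ξ hξ => (hstandard ul ur h).left_eq ξ (hξ.trans (neg_le_neg hΛ))
      right_eq := fun ξ hξ => (hstandard ul ur h).right_eq ξ (hΛ.trans hξ) }
  · have : lam * t ≤ Λ * t := by gcongr
    exact hspeed u hu w hw a b h t ht y ⟨by linarith [hy.1], by linarith [hy.2]⟩

end Glueing

/-! ### The variation function -/

/-- The variation function of `v`, normalized to vanish at `0`. -/
noncomputable def varFun {E : Type*} [PseudoEMetricSpace E] (v : ℝ → E) : ℝ → ℝ :=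
  variationOnFromTo v univ 0

theorem BoundedVariationOn.varFun_sub {E : Type*} [PseudoEMetricSpace E] {v : ℝ → E}
    (hv : BoundedVariationOn v univ) {a b : ℝ} (hab : a ≤ b) :
    varFun v b - varFun v a = (eVariationOn v (Icc a b)).toReal := by
  have := variationOnFromTo.add hv.locallyBoundedVariationOn (mem_univ 0) (mem_univ a) (mem_univ b)
  rw [varFun, ← this, add_sub_cancel_left, variationOnFromTo.eq_of_le _ _ hab, univ_inter]

theorem BoundedVariationOn.dist_le_varFun_sub {E : Type*} [PseudoMetricSpace E] {v : ℝ → E}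
    (hv : BoundedVariationOn v univ) {a b : ℝ} (hab : a ≤ b) :
    dist (v b) (v a) ≤ varFun v b - varFun v a := by
  rw [hv.varFun_sub hab]
  exact (hv.mono (subset_univ _)).dist_le (right_mem_Icc.2 hab) (left_mem_Icc.2 hab)

theorem BoundedVariationOn.varFun_sub_le {E : Type*} [PseudoEMetricSpace E] {v : ℝ → E}
    (hv : BoundedVariationOn v univ) (a b : ℝ) :
    varFun v b - varFun v a ≤ (eVariationOn v univ).toReal := by
  rcases le_total a b with hab | hab
  · rw [hv.varFun_sub hab]
    exact ENNReal.toReal_mono hv (eVariationOn.mono _ (subset_univ _))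
  · have := hv.varFun_sub hab
    have h1 : 0 ≤ (eVariationOn v (Icc b a)).toReal := ENNReal.toReal_nonneg
    have h2 : 0 ≤ (eVariationOn v univ).toReal := ENNReal.toReal_nonneg
    linarith

theorem BoundedVariationOn.monotone_varFun {E : Type*} [PseudoEMetricSpace E] {v : ℝ → E}
    (hv : BoundedVariationOn v univ) : Monotone (varFun v) := fun a b hab => by
  have := hv.varFun_sub hab
  have h1 : 0 ≤ (eVariationOn v (Icc a b)).toReal := ENNReal.toReal_nonneg
  linarith

theorem BoundedVariationOn.intervalIntegrable_of_measurable {E : Type*} [NormedAddCommGroup E]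
    [MeasurableSpace E] [BorelSpace E] [SecondCountableTopology E] {v : ℝ → E}
    (hv : BoundedVariationOn v univ) (hm : Measurable v) (a b : ℝ) :
    IntervalIntegrable v volume a b := by
  rw [intervalIntegrable_iff]
  refine Measure.integrableOn_of_bounded (M := (eVariationOn v univ).toReal + ‖v 0‖) (by simp)
    hm.aestronglyMeasurable (Eventually.of_forall fun x => ?_)
  have h1 := hv.dist_le (mem_univ x) (mem_univ 0)
  rw [dist_eq_norm] at h1
  have h2 := norm_le_norm_sub_add (v x) (v 0)
  linarith

/-! ### Variation from the `L¹` modulus of translation -/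

section Shift

variable {E : Type*} [NormedAddCommGroup E] [NormedSpace ℝ E] [CompleteSpace E]
  [MeasurableSpace E] [BorelSpace E] [SecondCountableTopology E]

/-- A right continuous function whose increments are of order `O(r)` in `L¹` is of bounded
variation. -/
theorem eVariationOn_le_of_forall_lintegral_shift_le {v : ℝ → E}
    (hint : ∀ a b, IntervalIntegrable v volume a b)
    (hv : ∀ x, ContinuousWithinAt v (Ici x) x) {C : ℝ≥0∞}
    (h : ∀ r : ℝ, 0 < r → ∫⁻ x, ‖v (x + r) - v x‖ₑ ≤ C * ENNReal.ofReal r) :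
    eVariationOn v univ ≤ C := by
  have hmeas : Measurable v := measurable_of_forall_continuousWithinAt_Ici hv
  -- The forward averages of `v` have variation at most `r⁻¹ ∫ ‖v (z + r) - v z‖ ≤ C` and converge
  -- pointwise to `v` by right continuity; the variation is lower semicontinuous under pointwise
  -- convergence.
  set m : ℝ → ℝ → E := fun r x => r⁻¹ • ∫ z in x..x + r, v z with hm
  have hlim : ∀ x, Tendsto (fun r => m r x) (𝓝[>] 0) (𝓝 (v x)) := by
    intro x
    have hd : HasDerivWithinAt (fun y => ∫ z in x..y, v z) (v x) (Ici x) x :=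
      intervalIntegral.integral_hasDerivWithinAt_right (hint x x)
        (hmeas.stronglyMeasurable.stronglyMeasurableAtFilter) ((hv x).mono Ioi_subset_Ici_self)
    have hs := hasDerivWithinAt_iff_tendsto_slope.1 hd.Ioi_of_Ici
    have hx : Tendsto (fun r : ℝ => x + r) (𝓝[>] 0) (𝓝[Ioi x \ {x}] x) := by
      refine tendsto_nhdsWithin_iff.2 ⟨?_, ?_⟩
      · have : Tendsto (fun r : ℝ => x + r) (𝓝 0) (𝓝 (x + 0)) := tendsto_const_nhds.add tendsto_id
        rw [add_zero] at this
        exact this.mono_left nhdsWithin_le_nhds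
      · filter_upwards [self_mem_nhdsWithin] with r hr
        have hr : 0 < r := hr
        simp [hr]
    refine (hs.comp hx).congr fun r => ?_
    simp [slope, hm]
  have hdiff : ∀ r : ℝ, 0 < r → ∀ x y, x ≤ y → ‖m r y - m r x‖ₑ
      ≤ ENNReal.ofReal r⁻¹ * ∫⁻ z in Ioc x y, ‖v (z + r) - v z‖ₑ := by
    intro r hr x y hxy
    have h1 : m r y - m r x = r⁻¹ • ∫ z in x..y, (v (z + r) - v z) := by
      have hs : IntervalIntegrable (fun z => v (z + r)) volume x y := by
        have := (hint (x + r) (y + r)).comp_add_right r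
        simpa using this
      have h2 := intervalIntegral.integral_add_adjacent_intervals (hint x y) (hint y (y + r))
      have h3 := intervalIntegral.integral_add_adjacent_intervals (hint x (x + r))
        (hint (x + r) (y + r))
      rw [intervalIntegral.integral_sub hs (hint x y), intervalIntegral.integral_comp_add_right,
        hm, ← smul_sub]
      congr 1
      rw [sub_eq_sub_iff_add_eq_add, add_comm, h2, ← h3]
      exact add_comm _ _
    rw [h1, enorm_smul, Real.enorm_eq_ofReal (by positivity), intervalIntegral.integral_of_le hxy]
    gcongr
    exact enorm_integral_le_lintegral_enorm _
  have hvar : ∀ r : ℝ, 0 < r → eVariationOn (m r) univ ≤ C := by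
    intro r hr
    refine iSup_le fun p => ?_
    obtain ⟨k, u, hu, -⟩ := p
    have hsum : ∀ k : ℕ, ∑ i ∈ Finset.range k, ∫⁻ z in Ioc (u i) (u (i + 1)), ‖v (z + r) - v z‖ₑ
        = ∫⁻ z in Ioc (u 0) (u k), ‖v (z + r) - v z‖ₑ := by
      intro k
      induction k with
      | zero => simp
      | succ k ih =>
        rw [Finset.sum_range_succ, ih, ← lintegral_union measurableSet_Ioc
          (Ioc_disjoint_Ioc_of_le le_rfl), Ioc_union_Ioc_eq_Ioc (hu (Nat.zero_le k))
          (hu k.le_succ)]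
    calc ∑ i ∈ Finset.range k, edist (m r (u (i + 1))) (m r (u i))
        ≤ ∑ i ∈ Finset.range k, ENNReal.ofReal r⁻¹ *
            ∫⁻ z in Ioc (u i) (u (i + 1)), ‖v (z + r) - v z‖ₑ :=
          Finset.sum_le_sum fun i _ => by
            rw [edist_eq_enorm_sub]; exact hdiff r hr _ _ (hu i.le_succ)
      _ = ENNReal.ofReal r⁻¹ * ∫⁻ z in Ioc (u 0) (u k), ‖v (z + r) - v z‖ₑ := by
          rw [← Finset.mul_sum, hsum]
      _ ≤ ENNReal.ofReal r⁻¹ * (C * ENNReal.ofReal r) := by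
          gcongr
          exact (setLIntegral_le_lintegral _ _).trans (h r hr)
      _ = C := by
          rw [mul_comm, mul_assoc, ← ENNReal.ofReal_mul hr.le, mul_inv_cancel₀ hr.ne',
            ENNReal.ofReal_one, mul_one]
  by_contra! hlt
  have := eVariationOn.lowerSemicontinuous_aux (p := 𝓝[>] (0 : ℝ)) (fun x _ => hlim x) hlt
  obtain ⟨r, hr1, hr2⟩ := (this.and self_mem_nhdsWithin).exists
  exact (hvar r hr2).not_gt hr1

end Shift

/-! ### The scalar equation `(ξ - μ) dW = dq` -/

/-- The possible decrease is of second order: over a uniform partition the errors telescope to the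
mesh size times `G b - G a`, which tends to `0`. -/
theorem le_of_forall_neg_mul_sub_le {Ψ G : ℝ → ℝ} {a b : ℝ} (hab : a ≤ b)
    (h : ∀ x y, a ≤ x → x ≤ y → y ≤ b → -((y - x) * (G y - G x)) ≤ Ψ y - Ψ x) : Ψ a ≤ Ψ b := by
  have key : ∀ N : ℕ, -((b - a) / (N + 1) * (G b - G a)) ≤ Ψ b - Ψ a := by
    intro N
    have hN : (0 : ℝ) < N + 1 := by positivity
    set p : ℕ → ℝ := fun j => a + (b - a) / (N + 1) * j with hp
    have hm : 0 ≤ (b - a) / ((N : ℝ) + 1) := div_nonneg (by linarith) hN.le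
    have hp0 : p 0 = a := by simp [hp]
    have hpN : p (N + 1) = b := by
      simp only [hp]; push_cast
      field_simp
      ring
    have hstep : ∀ j, p (j + 1) - p j = (b - a) / (N + 1) := fun j => by
      simp only [hp]; push_cast; ring
    have hmono : Monotone p := monotone_nat_of_le_succ fun j => by linarith [hstep j]
    have hsum : ∀ F : ℝ → ℝ, ∑ j ∈ Finset.range (N + 1), (F (p (j + 1)) - F (p j)) = F b - F a :=
      fun F => by rw [Finset.sum_range_sub fun j => F (p j), hp0, hpN]
    rw [← hsum Ψ, ← hsum G, Finset.mul_sum, ← Finset.sum_neg_distrib]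
    refine Finset.sum_le_sum fun j hj => ?_
    rw [← hstep j]
    refine h _ _ (hp0 ▸ hmono (Nat.zero_le j)) (hmono j.le_succ) (hpN ▸ hmono ?_)
    exact Finset.mem_range.1 hj
  have hlim : Tendsto (fun N : ℕ => -((b - a) / ((N : ℝ) + 1) * (G b - G a))) atTop (𝓝 0) := by
    have h1 := tendsto_one_div_add_atTop_nhds_zero_nat (𝕜 := ℝ)
    have h2 := (h1.const_mul (b - a)).mul_const (G b - G a) |>.neg
    simpa [div_eq_mul_inv] using h2
  linarith [le_of_tendsto' hlim key]

/-- Formally, `d((x - μ) |W|) ≥ |W| dx - |dq|`, integrated from `μ`, where the weight vanishes, to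
`M`, where `W` does. To avoid a calculus of measures, the sign of `W` is frozen at the left end of
each small interval. This costs the length of the interval times the variation of `W`, an error that
`le_of_forall_neg_mul_sub_le` absorbs. -/
theorem integral_abs_le_of_conservation_right {W q VW Vq : ℝ → ℝ} {μ M : ℝ} (hM : μ ≤ M)
    (hint : ∀ a b, IntervalIntegrable W volume a b)
    (hVW : ∀ a b, a ≤ b → |W b - W a| ≤ VW b - VW a)
    (hVq : ∀ a b, a ≤ b → |q b - q a| ≤ Vq b - Vq a)
    (hrel : ∀ a b, a ≤ b →
      (b - μ) * W b - (a - μ) * W a = q b - q a + ∫ x in a..b, W x)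
    (hWM : W M = 0) : ∫ x in μ..M, |W x| ≤ Vq M - Vq μ := by
  have habs : ∀ a b, IntervalIntegrable (fun x => |W x|) volume a b := fun a b => (hint a b).abs
  have key : ∀ x y, μ ≤ x → x ≤ y → y ≤ M → -((y - x) * (2 * VW y - 2 * VW x)) ≤
      ((y - μ) * |W y| + Vq y - ∫ z in μ..y, |W z|) -
        ((x - μ) * |W x| + Vq x - ∫ z in μ..x, |W z|) := by
    intro x y hx hxy hy
    have h1 : (∫ z in μ..y, |W z|) - ∫ z in μ..x, |W z| = ∫ z in x..y, |W z| :=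
      intervalIntegral.integral_interval_sub_left (habs _ _) (habs _ _)
    set σ : ℝ := SignType.cast (SignType.sign (W x)) with hσ
    have hσW : σ * W x = |W x| := sign_mul_self _
    have hσ1 : |σ| ≤ 1 := by
      rw [hσ]; rcases SignType.sign (W x) with _ | _ | _ <;> simp
    have hσle : ∀ t, σ * t ≤ |t| := fun t => (le_abs_self _).trans (by
      rw [abs_mul]; nlinarith [abs_nonneg t])
    have hpt : ∀ z ∈ Icc x y, |W z| - 2 * (VW y - VW x) ≤ σ * W z := by
      intro z hz
      have h2 := hVW x z hz.1
      have h3 := (abs_nonneg _).trans (hVW z y hz.2)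
      have h4 : |W z| ≤ |W z - W x| + |W x| := by
        simpa using abs_add_le (W z - W x) (W x)
      have h5 : -|W z - W x| ≤ σ * (W z - W x) := by
        have := hσle (-(W z - W x))
        rw [abs_neg] at this
        linarith
      nlinarith
    have hI : (∫ z in x..y, |W z|) - 2 * (VW y - VW x) * (y - x) ≤ σ * ∫ z in x..y, W z := by
      rw [← intervalIntegral.integral_const_mul]
      have h2 : ∫ z in x..y, (|W z| - 2 * (VW y - VW x))
          = (∫ z in x..y, |W z|) - 2 * (VW y - VW x) * (y - x) := by
        rw [intervalIntegral.integral_sub (habs _ _) (by simp)]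
        simp
        ring
      rw [← h2]
      exact intervalIntegral.integral_mono_on hxy ((habs _ _).sub (by simp))
        ((hint _ _).const_mul _) hpt
    have hr := hrel x y hxy
    have h6 : σ * ((y - μ) * W y) ≤ (y - μ) * |W y| := by
      have := mul_le_mul_of_nonneg_left (hσle (W y)) (show 0 ≤ y - μ by linarith)
      linarith
    have h7 : -(Vq y - Vq x) ≤ σ * (q y - q x) := by
      have := hσle (-(q y - q x))
      rw [abs_neg] at this
      linarith [hVq x y hxy]
    have h8 : σ * ((y - μ) * W y) - (x - μ) * |W x| = σ * (q y - q x) + σ * ∫ z in x..y, W z := by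
      rw [← hσW, ← mul_add, ← hr]; ring
    nlinarith
  have := le_of_forall_neg_mul_sub_le (G := fun x => 2 * VW x) hM key
  simp [hWM] at this
  linarith

/-- If `(ξ - μ) dW = dq` and `W` vanishes near `±∞`, then the `L¹` norm of `W` is bounded by the
total variation of `q`. -/
theorem lintegral_enorm_le_eVariationOn_of_conservation {W q VW : ℝ → ℝ} {μ M : ℝ}
    (hM : |μ| ≤ M) (hint : ∀ a b, IntervalIntegrable W volume a b)
    (hVW : ∀ a b, a ≤ b → |W b - W a| ≤ VW b - VW a) (hq : BoundedVariationOn q univ)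
    (hrel : ∀ a b, a ≤ b →
      (b - μ) * W b - (a - μ) * W a = q b - q a + ∫ x in a..b, W x)
    (hW : ∀ x, M ≤ |x| → W x = 0) : ∫⁻ x, ‖W x‖ₑ ≤ eVariationOn q univ := by
  set Vq : ℝ → ℝ := varFun q with hVqdef
  have hVq : ∀ a b, a ≤ b → |q b - q a| ≤ Vq b - Vq a := fun a b hab =>
    hq.dist_le_varFun_sub hab
  obtain ⟨hM1, hM2⟩ := abs_le.1 hM
  have hM0 : 0 ≤ M := (abs_nonneg _).trans hM
  have h1 : ∫ x in μ..M, |W x| ≤ Vq M - Vq μ :=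
    integral_abs_le_of_conservation_right hM2 hint hVW hVq hrel
      (hW M (le_abs_self _))
  -- The left half is the right half after the reflection `x ↦ -x`.
  have h2 : ∫ x in -M..μ, |W x| ≤ Vq μ - Vq (-M) := by
    have hint' : ∀ a b, IntervalIntegrable (fun x => W (-x)) volume a b := fun a b => by
      simpa using (IntervalIntegrable.iff_comp_neg (f := W)).1 (hint (-a) (-b))
    have := integral_abs_le_of_conservation_right (W := fun x => W (-x)) (q := fun x => -q (-x))
      (VW := fun x => -VW (-x)) (Vq := fun x => -Vq (-x)) (μ := -μ) (M := M) (by linarith) hint'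
      (fun a b hab => ?_) (fun a b hab => ?_) (fun a b hab => ?_) (hW _ (by simp [le_abs_self]))
    · rw [intervalIntegral.integral_comp_neg fun x => |W x|, neg_neg] at this
      linarith
    · rw [abs_sub_comm]
      linarith [hVW (-b) (-a) (neg_le_neg hab)]
    · have := hVq (-b) (-a) (neg_le_neg hab)
      rw [show -q (-b) - -q (-a) = q (-a) - q (-b) by ring]
      linarith
    · have := hrel (-b) (-a) (neg_le_neg hab)
      rw [intervalIntegral.integral_comp_neg]
      linarith
  have habs : ∀ a b, IntervalIntegrable (fun x => |W x|) volume a b := fun a b => (hint a b).abs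
  have h3 : ∫ x in -M..M, |W x| ≤ Vq M - Vq (-M) := by
    rw [← intervalIntegral.integral_add_adjacent_intervals (habs (-M) μ) (habs μ M)]
    linarith
  have h4 : ∫⁻ x, ‖W x‖ₑ = ∫⁻ x in Ioc (-M) M, ‖W x‖ₑ := by
    rw [← lintegral_indicator measurableSet_Ioc]
    refine lintegral_congr_ae (Eventually.of_forall fun x => ?_)
    by_cases hx : x ∈ Ioc (-M) M
    · simp [hx]
    · have : M ≤ |x| := by
        by_contra! h
        exact hx ⟨(abs_lt.1 h).1, (abs_lt.1 h).2.le⟩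
      simp [hx, hW x this]
  have h5 : ∫⁻ x in Ioc (-M) M, ‖W x‖ₑ = ENNReal.ofReal (∫ x in -M..M, |W x|) := by
    rw [intervalIntegral.integral_of_le (by linarith), ofReal_integral_eq_lintegral_ofReal
      ((intervalIntegrable_iff_integrableOn_Ioc_of_le (by linarith)).1 (habs _ _))
      (Eventually.of_forall fun x => abs_nonneg _)]
    exact lintegral_congr fun x => Real.enorm_eq_ofReal_abs _
  rw [h4, h5]
  refine (ENNReal.ofReal_le_ofReal h3).trans ?_
  rw [hVqdef, hq.varFun_sub (by linarith)]
  exact ENNReal.ofReal_toReal_le.trans (eVariationOn.mono _ (subset_univ _))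

/-! ### Self-similarity and the variation of Riemann solutions -/

section Jump

variable {n : ℕ} {Ω : Set (State n)} {f : State n → State n} {D : Set (ℝ → State n)}
  {S : ℝ → (ℝ → State n) → ℝ → State n}

/-- The function with a single jump at `x₀` from `ul` to `ur`. -/
noncomputable def jump (x₀ : ℝ) (ul ur : State n) : ℝ → State n :=
  fun x => if x < x₀ then ul else ur

theorem jump_eq_stepFun (x₀ : ℝ) (ul ur : State n) :
    jump x₀ ul ur = stepFun (ι := Unit) ul (fun _ => x₀) (fun _ => ur - ul) := by
  funext y
  by_cases h : y < x₀
  · simp [jump, stepFun, h, h.not_ge]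
  · simp [jump, stepFun, h, not_lt.1 h]

theorem jump_mem_of_riemannDatum_mem (hD : IsSRSDomain Ω D) {ul ur : State n}
    (h : riemannDatum ul ur ∈ D) (x₀ : ℝ) : jump x₀ ul ur ∈ D := by
  simpa [riemannDatum] using! hD.jump_mem h (show (-1 : ℝ) ≤ 0 by norm_num) x₀

theorem GeneratesSRS.apply_jump (hf : GeneratesSRS Ω f D S) {ul ur : State n}
    (h : riemannDatum ul ur ∈ D) (x₀ : ℝ) {t : ℝ} (ht : 0 < t) (y : ℝ) :
    S t (jump x₀ ul ur) y = S 1 (riemannDatum ul ur) ((y - x₀) / t) := by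
  obtain ⟨lam, hlam⟩ := hf.exists_isSpeedBound
  have hmem := jump_mem_of_riemannDatum_mem hf.domain h x₀
  rw [jump_eq_stepFun] at hmem ⊢
  -- With a single jump there is no separation condition, so the speed bound may be enlarged until
  -- the cone contains `y`.
  have hy : |y - x₀| ≤ max lam (|y - x₀| / t) * t := by
    rw [← div_le_iff₀ ht]; exact le_max_right _ _
  have := ((hlam _ (le_max_left lam (|y - x₀| / t))).near_jump hmem ht
    (fun _ _ h => absurd h (lt_irrefl _)) () y hy).2
  simpa [stepFunLeft, stepFun] using this

theorem lOneDist_jump_jump_le (ul ur : State n) (a : ℝ) {r : ℝ} (hr : 0 < r) :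
    lOneDist (jump a ul ur) (jump (a + r) ul ur) ≤ ‖ur - ul‖ₑ * ENNReal.ofReal r := by
  have : ∀ x, ‖jump a ul ur x - jump (a + r) ul ur x‖ₑ
      ≤ (Ico a (a + r)).indicator (fun _ => ‖ur - ul‖ₑ) x := by
    intro x
    by_cases h1 : x < a
    · simp [jump, h1, h1.trans (show a < a + r by linarith)]
    · by_cases h2 : x < a + r
      · simp [jump, h1, h2, not_lt.1 h1]
      · simp [jump, h1, h2]
  refine (lintegral_mono this).trans ?_
  rw [lintegral_indicator measurableSet_Ico, setLIntegral_const, Real.volume_Ico]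
  simp

/-- Translating the datum by `r` moves it by at most `r ‖ur - ul‖` in `L¹` and translates the
solution by `r`. Lipschitz dependence thus bounds the `L¹` translation modulus of the profile, hence
its variation. -/
theorem GeneratesSRS.eVariationOn_riemann_le (hf : GeneratesSRS Ω f D S) {L : ℝ≥0}
    (hL : IsLipschitzConst D S L) {ul ur : State n} (h : riemannDatum ul ur ∈ D) :
    eVariationOn (S 1 (riemannDatum ul ur)) univ ≤ L * ‖ur - ul‖ₑ := by
  have hmem := hf.mapsTo 1 zero_le_one _ h
  refine eVariationOn_le_of_forall_lintegral_shift_le (fun a b =>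
    (hf.domain.boundedVariation _ hmem).intervalIntegrable_of_measurable
      (hf.domain.measurable hmem) a b) (hf.domain.rightCont _ hmem) fun r hr => ?_
  have h1 : ∀ a y, S 1 (jump a ul ur) y = S 1 (riemannDatum ul ur) (y - a) := fun a y => by
    simpa using hf.apply_jump h a one_pos y
  have h2 := hL.2 1 1 zero_le_one zero_le_one _
    (jump_mem_of_riemannDatum_mem hf.domain h (-r)) _ (jump_mem_of_riemannDatum_mem hf.domain h 0)
  have h3 := lOneDist_jump_jump_le ul ur (-r) hr
  rw [neg_add_cancel] at h3
  simp only [lOneDist, h1, sub_neg_eq_add, sub_zero] at h2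
  refine h2.trans ?_
  simp only [sub_self, abs_zero, ENNReal.ofReal_zero, zero_add]
  rw [mul_assoc]
  gcongr
  exact h3

end Jump

/-! ### Linearization of small Riemann problems -/

section Linearization

variable {n : ℕ} {Ω : Set (State n)} {f : State n → State n} {D : Set (ℝ → State n)}
  {S : ℝ → (ℝ → State n) → ℝ → State n}

/-- The conservation law for self-similar solutions, in integrated form. -/
theorem IsStandardRiemannSolution.conservation (hΩ : IsOpen Ω) (hf : ContDiffOn ℝ 1 f Ω)
    {lam : ℝ} {ul ur : State n} {ω : ℝ → State n}
    (hω : IsStandardRiemannSolution Ω f lam ul ur ω) {a b : ℝ} (hab : a ≤ b) :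
    (f (ω b) - b • ω b) - (f (ω a) - a • ω a) = -∫ x in a..b, ω x := by
  have hdiff : ∀ u ∈ Ω, DifferentiableAt ℝ f u := fun u hu =>
    (hf.differentiableOn one_ne_zero).differentiableAt (hΩ.mem_nhds hu)
  have hint := hω.boundedVariation.intervalIntegrable_of_measurable
    (measurable_of_forall_continuousWithinAt_Ici hω.rightCont)
  obtain ⟨J, hJ1, hJ2⟩ := hω.waves
  -- The Rankine–Hugoniot condition makes this combination continuous across shocks, so the finitely
  -- many exceptional points do not contribute.
  have hcont : Continuous fun ξ => f (ω ξ) - ξ • ω ξ := by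
    refine continuous_iff_continuousAt.2 fun ξ => ?_
    by_cases hξ : ξ ∈ J
    · refine continuousAt_iff_continuous_left'_right'.2 ⟨?_, ?_⟩
      · obtain ⟨ωl, hlim, hadm⟩ := hJ2 ξ hξ
        have hmem : ωl ∈ Ω := by
          rcases hadm with h | ⟨-, γ, s, -, -, h0, -, h⟩
          · exact h ▸ hω.mem ξ
          · exact h0 ▸ (h 0 (by simp)).1
        have hval : f ωl - ξ • ωl = f (ω ξ) - ξ • ω ξ := by
          rcases hadm with h | ⟨h, -⟩
          · rw [h]
          · rw [smul_sub, sub_eq_sub_iff_sub_eq_sub] at h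
            rw [eq_comm, sub_eq_sub_iff_sub_eq_sub]
            rw [← sub_eq_sub_iff_sub_eq_sub] at h
            exact h
        have h1 := ((hdiff ωl hmem).continuousAt.tendsto.comp hlim).sub
          ((tendsto_id.mono_left nhdsWithin_le_nhds).smul hlim)
        simp only [ContinuousWithinAt]
        rw [← hval]
        exact h1
      · exact ((hdiff _ (hω.mem ξ)).continuousAt.comp_continuousWithinAt
          ((hω.rightCont ξ).mono Ioi_subset_Ici_self)).sub
          (continuousWithinAt_id.smul ((hω.rightCont ξ).mono Ioi_subset_Ici_self))
    · obtain ⟨ω', h1, -⟩ := hJ1 ξ hξ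
      exact ((hdiff _ (hω.mem ξ)).continuousAt.comp h1.continuousAt).sub
        (continuousAt_id.smul h1.continuousAt)
  rw [← intervalIntegral.integral_neg]
  refine (integral_eq_of_hasDerivAt_off_countable_of_le (fun ξ => f (ω ξ) - ξ • ω ξ)
    (fun ξ => -ω ξ) hab J.countable_toSet hcont.continuousOn (fun ξ hξ => ?_) (hint a b).neg).symm
  obtain ⟨ω', h1, h2⟩ := hJ1 ξ hξ.2
  have h3 := ((hdiff _ (hω.mem ξ)).hasFDerivAt.comp_hasDerivAt ξ h1).sub
    ((hasDerivAt_id ξ).smul h1)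
  convert! h3 using 1
  rw [h2]
  simp

/-- This is `(x - μ) dH = 0` in integrated form for a step `H` at `μ`: subtracting the linear wave
leaves the equation `(x - μ) dW = dq` unchanged. -/
theorem integral_heaviside (μ c : ℝ) {a b : ℝ} (hab : a ≤ b) :
    ∫ x in a..b, (if μ ≤ x then c else 0) =
      (b - μ) * (if μ ≤ b then c else 0) - (a - μ) * (if μ ≤ a then c else 0) := by
  have hF : (fun x => (x - μ) * (if μ ≤ x then c else 0)) = fun x => max (x - μ) 0 * c := by
    funext x
    by_cases h : μ ≤ x
    · simp [h]
    · simp [h, (not_le.1 h).le]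
  refine integral_eq_of_hasDerivAt_off_countable_of_le
    (fun x => (x - μ) * (if μ ≤ x then c else 0)) _ hab (countable_singleton μ) ?_
    (fun x hx => ?_) ?_
  · rw [hF]; fun_prop
  · rcases lt_or_gt_of_ne (show x ≠ μ from hx.2) with h | h
    · rw [if_neg h.not_ge]
      refine (hasDerivAt_const x (0 : ℝ)).congr_of_eventuallyEq ?_
      filter_upwards [Iio_mem_nhds h] with y hy
      simp [(mem_Iio.1 hy).not_ge]
    · rw [if_pos h.le]
      have := ((hasDerivAt_id x).sub_const μ).mul_const c
      rw [one_mul] at this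
      refine this.congr_of_eventuallyEq ?_
      filter_upwards [Ioi_mem_nhds h] with y hy
      simp [(mem_Ioi.1 hy).le]
  · rw [intervalIntegrable_iff]
    refine Measure.integrableOn_of_bounded (M := |c|) (by simp)
      (Measurable.ite measurableSet_Ici measurable_const measurable_const).aestronglyMeasurable
      (Eventually.of_forall fun x => ?_)
    split_ifs <;> simp

/-- Small Riemann problems are solved, up to a small relative error, by the Riemann problems of
the linearized system. -/
theorem GeneratesSRS.exists_riemann_linear_approx (hf : GeneratesSRS Ω f D S) {u₀ : State n}
    (hu₀ : u₀ ∈ Ω) {ε : ℝ} (hε : 0 < ε) : ∃ δ > 0, ∀ ul ur, ‖ul - u₀‖ ≤ δ → ‖ur - u₀‖ ≤ δ →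
      riemannDatum ul ur ∈ D → ∀ {ι : Type} (s : Finset ι) (σ : ι → ℝ) (r : ι → State n),
      (∀ p, fderiv ℝ f u₀ (r p) = σ p • r p) → ∑ p ∈ s, r p = ur - ul →
      ∫⁻ ξ, ‖S 1 (riemannDatum ul ur) ξ - (ul + ∑ p ∈ s, if σ p ≤ ξ then r p else 0)‖ₑ
        ≤ ENNReal.ofReal (ε * ‖ur - ul‖) := by
  obtain ⟨b, μ, hb⟩ := hf.hyperbolic u₀ hu₀
  obtain ⟨L, hL⟩ := hf.lipschitz
  obtain ⟨lam, hlam'⟩ := hf.exists_isSpeedBound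
  have hlam := hlam' lam le_rfl
  set A := fderiv ℝ f u₀ with hA
  -- The coordinate functionals of the eigenbasis are left eigenvectors of `A`; they reduce the
  -- estimate to scalar ones.
  let l : Fin n → State n →L[ℝ] ℝ := fun i => LinearMap.toContinuousLinearMap (b.coord i)
  have hl : ∀ i v, l i v = b.repr v i := fun i v => rfl
  have hlA : ∀ i v, l i (A v) = μ i * l i v := by
    intro i v
    have h1 : ((l i).comp A : State n →ₗ[ℝ] ℝ) = ((μ i) • l i : State n →L[ℝ] ℝ) := by
      refine b.ext fun j => ?_
      by_cases hij : j = i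
      · simp [hl, hb, hij]
      · simp [hl, hb, hij]
    exact congrArg (fun g : State n →ₗ[ℝ] ℝ => g v) h1
  set K : ℝ := ∑ i, ‖b i‖ * ‖l i‖ with hK
  have hK0 : 0 ≤ K := Finset.sum_nonneg fun i _ => by positivity
  -- `η` will be the Lipschitz constant of `f - A` near `u₀`, and `K * (η * L)` the factor collected
  -- in the final estimate.
  obtain ⟨η, hη0, hη⟩ : ∃ η : ℝ≥0, 0 < η ∧ K * (η * L) ≤ ε := by
    refine ⟨Real.toNNReal (ε / (K * L + 1)), Real.toNNReal_pos.2 (by positivity), ?_⟩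
    rw [Real.coe_toNNReal _ (by positivity), div_mul_eq_mul_div, mul_div_assoc',
      div_le_iff₀ (by positivity)]
    nlinarith
  have hstrict : HasStrictFDerivAt f A u₀ :=
    (hf.smooth.contDiffAt (hf.isOpen.mem_nhds hu₀)).hasStrictFDerivAt one_ne_zero
  obtain ⟨V, hV, happ⟩ := hstrict.approximates_deriv_on_nhds (c := η) (Or.inr hη0)
  obtain ⟨ρ, hρ, hball⟩ := Metric.mem_nhds_iff.1 hV
  -- With `δ` this radius, the profile stays within `L ‖ur - ul‖ ≤ 2 L δ` of `ul`, hence within `(1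
  -- + 2 L) δ = ρ / 2` of `u₀`.
  refine ⟨ρ / (2 * (1 + 2 * L)), by positivity, fun ul ur hul hur hmem ι s σ r hr hsum => ?_⟩
  set ω := S 1 (riemannDatum ul ur) with hω
  have hstd := hlam.standard ul ur hmem
  rw [← hω] at hstd
  have hTV : eVariationOn ω univ ≤ L * ‖ur - ul‖ₑ := hf.eVariationOn_riemann_le hL hmem
  have hbv := hstd.boundedVariation
  have hmeas := measurable_of_forall_continuousWithinAt_Ici hstd.rightCont
  have hjump : ‖ur - ul‖ ≤ 2 * (ρ / (2 * (1 + 2 * L))) := by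
    rw [← sub_sub_sub_cancel_right ur ul u₀]
    exact (norm_sub_le _ _).trans (by linarith)
  have hmemV : ∀ ξ, ω ξ ∈ V := by
    intro ξ
    refine hball ?_
    have h1 : edist (ω ξ) (ω (-lam)) ≤ L * ‖ur - ul‖ₑ :=
      (eVariationOn.edist_le _ (mem_univ _) (mem_univ _)).trans hTV
    rw [hstd.left_eq _ le_rfl, edist_dist, ← ofReal_norm, ← ENNReal.ofReal_coe_nnreal,
      ← ENNReal.ofReal_mul (by positivity), ENNReal.ofReal_le_ofReal_iff (by positivity)] at h1
    have h2 := dist_triangle (ω ξ) ul u₀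
    rw [dist_eq_norm ul] at h2
    have h3 : (L : ℝ) * ‖ur - ul‖ ≤ L * (2 * (ρ / (2 * (1 + 2 * L)))) := by gcongr
    have h4 : ρ / (2 * (1 + 2 * L)) + L * (2 * (ρ / (2 * (1 + 2 * L)))) = ρ / 2 := by
      field_simp
    rw [Metric.mem_ball]
    linarith
  set q : Fin n → ℝ → ℝ := fun i ξ => l i (f (ω ξ) - A (ω ξ)) with hq
  have hqvar : ∀ i, eVariationOn (q i) univ ≤ ENNReal.ofReal (‖l i‖ * (η * (L * ‖ur - ul‖))) := by
    intro i
    have h1 : LipschitzOnWith η (fun u => f u - A u) V := by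
      refine LipschitzOnWith.of_dist_le_mul fun x hx y hy => ?_
      rw [dist_eq_norm, dist_eq_norm, sub_sub_sub_comm, ← map_sub]
      exact happ x hx y hy
    have h2 := ((l i).lipschitz.comp_lipschitzOnWith h1).comp_eVariationOn_le (g := ω) (s := univ)
      (fun ξ _ => hmemV ξ)
    refine h2.trans ?_
    have h3 : ENNReal.ofReal (‖l i‖ * (η * (L * ‖ur - ul‖)))
        = ((‖l i‖₊ * η : ℝ≥0) : ℝ≥0∞) * (L * ‖ur - ul‖ₑ) := by
      rw [← mul_assoc, ENNReal.ofReal_mul (by positivity), ENNReal.ofReal_mul (by positivity),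
        ofReal_norm, ENNReal.ofReal_coe_nnreal, ENNReal.ofReal_mul (by positivity),
        ENNReal.ofReal_coe_nnreal, ofReal_norm, ENNReal.coe_mul]
      rfl
    rw [h3]
    gcongr
  set W : Fin n → ℝ → ℝ :=
    fun i ξ => l i (ω ξ) - (l i ul + if μ i ≤ ξ then l i (ur - ul) else 0) with hW
  have hmain : ∀ i, ∫⁻ ξ, ‖W i ξ‖ₑ ≤ ENNReal.ofReal (‖l i‖ * (η * (L * ‖ur - ul‖))) := by
    intro i
    have hωint := hbv.intervalIntegrable_of_measurable hmeas
    have hlint : ∀ a b, IntervalIntegrable (fun ξ => l i (ω ξ)) volume a b := fun a b =>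
      ⟨(l i).integrable_comp (hωint a b).1, (l i).integrable_comp (hωint a b).2⟩
    have hHint : ∀ a b, IntervalIntegrable (fun ξ => if μ i ≤ ξ then l i (ur - ul) else 0)
        volume a b := fun a b => by
      rw [intervalIntegrable_iff]
      refine Measure.integrableOn_of_bounded (M := |l i (ur - ul)|) (by simp)
        (Measurable.ite measurableSet_Ici measurable_const measurable_const).aestronglyMeasurable
        (Eventually.of_forall fun x => ?_)
      split_ifs <;> simp
    refine (lintegral_enorm_le_eVariationOn_of_conservation (q := q i) (μ := μ i)
      (M := max lam (|μ i| + 1)) (VW := fun ξ => ‖l i‖ * varFun ω ξ +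
        if μ i ≤ ξ then |l i (ur - ul)| else 0) ?_ (fun a b => ?_) (fun a b hab => ?_) ?_
      (fun a b hab => ?_) fun ξ hξ => ?_).trans (hqvar i)
    · exact le_max_of_le_right (by linarith)
    · exact (hlint a b).sub (by simpa using (intervalIntegrable_const).add (hHint a b))
    · have h1 : |l i (ω b) - l i (ω a)| ≤ ‖l i‖ * (varFun ω b - varFun ω a) := by
        rw [← map_sub, ← Real.norm_eq_abs]
        refine ((l i).le_opNorm _).trans ?_
        gcongr
        rw [← dist_eq_norm]
        exact hbv.dist_le_varFun_sub hab
      have h2 : |(if μ i ≤ b then l i (ur - ul) else 0) - (if μ i ≤ a then l i (ur - ul) else 0)|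
          ≤ (if μ i ≤ b then |l i (ur - ul)| else 0) - if μ i ≤ a then |l i (ur - ul)| else 0 := by
        by_cases h3 : μ i ≤ a
        · simp [h3, h3.trans hab]
        · by_cases h4 : μ i ≤ b <;> simp [h3, h4]
      have h3 : W i b - W i a = (l i (ω b) - l i (ω a)) -
          ((if μ i ≤ b then l i (ur - ul) else 0) - (if μ i ≤ a then l i (ur - ul) else 0)) := by
        simp only [hW]; ring
      rw [h3]
      refine (abs_sub _ _).trans ?_
      linarith
    · exact ne_top_of_le_ne_top ENNReal.ofReal_ne_top (hqvar i)
    · have h1 := congrArg (l i) (hstd.conservation hf.isOpen hf.smooth hab)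
      have h2 : l i (∫ x in a..b, ω x) = ∫ x in a..b, l i (ω x) :=
        ((l i).intervalIntegral_comp_comm (hωint a b)).symm
      have h3 := integral_heaviside (μ i) (l i (ur - ul)) hab
      have h4 : ∫ x in a..b, W i x = (∫ x in a..b, l i (ω x)) - (l i ul * (b - a) +
          ∫ x in a..b, (if μ i ≤ x then l i (ur - ul) else 0)) := by
        rw [intervalIntegral.integral_sub (hlint a b)
          ((intervalIntegrable_const).add (hHint a b)),
          intervalIntegral.integral_add intervalIntegrable_const (hHint a b)]
        simp [mul_comm]
      rw [map_neg, h2, map_sub, map_sub, map_sub, map_smul, map_smul, smul_eq_mul,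
        smul_eq_mul] at h1
      rw [h4, h3]
      simp only [hW, hq, map_sub (l i) (f _) (A _), hlA]
      linarith
    · have h1 := (le_max_left lam (|μ i| + 1)).trans hξ
      have h2 := (le_max_right lam (|μ i| + 1)).trans hξ
      rcases le_or_gt 0 ξ with h0 | h0
      · rw [abs_of_nonneg h0] at h1 h2
        simp only [hW, hstd.right_eq ξ h1, map_sub]
        rw [if_pos (by linarith [le_abs_self (μ i)])]
        ring
      · rw [abs_of_neg h0] at h1 h2
        simp only [hW, hstd.left_eq ξ (by linarith)]
        rw [if_neg (by linarith [neg_abs_le (μ i)])]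
        ring
  -- An eigenvector has a nonzero `i`-th coordinate only if its eigenvalue is `μ i`, so any
  -- splitting of the jump into eigenvectors yields the same linear wave.
  have hcoord : ∀ i ξ, l i (ω ξ - (ul + ∑ p ∈ s, if σ p ≤ ξ then r p else 0)) = W i ξ := by
    intro i ξ
    have h1 : ∀ p, l i (if σ p ≤ ξ then r p else 0) = if μ i ≤ ξ then l i (r p) else 0 := by
      intro p
      by_cases h0 : l i (r p) = 0
      · split_ifs <;> simp [h0]
      · have h2 := hlA i (r p)
        rw [hr, map_smul, smul_eq_mul] at h2
        rw [mul_right_cancel₀ h0 h2]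
        split_ifs <;> simp
    simp only [hW, map_sub (l i) (ω ξ), map_add, map_sum, h1]
    rw [← hsum, map_sum]
    split_ifs <;> simp
  calc ∫⁻ ξ, ‖ω ξ - (ul + ∑ p ∈ s, if σ p ≤ ξ then r p else 0)‖ₑ
      ≤ ∫⁻ ξ, ∑ i, ‖b i‖ₑ * ‖W i ξ‖ₑ := by
        refine lintegral_mono fun ξ => ?_
        rw [← b.sum_repr (ω ξ - (ul + ∑ p ∈ s, if σ p ≤ ξ then r p else 0))]
        refine (enorm_sum_le _ _).trans (Finset.sum_le_sum fun i _ => ?_)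
        rw [enorm_smul, ← hl, hcoord, mul_comm]
    _ = ∑ i, ‖b i‖ₑ * ∫⁻ ξ, ‖W i ξ‖ₑ := by
        have hWm : ∀ i, Measurable fun ξ => ‖W i ξ‖ₑ := fun i =>
          (((l i).measurable.comp hmeas).sub (measurable_const.add
            (Measurable.ite measurableSet_Ici measurable_const measurable_const))).enorm
        rw [lintegral_finsetSum _ fun i _ => (hWm i).const_mul _]
        exact Finset.sum_congr rfl fun i _ => lintegral_const_mul _ (hWm i)
    _ ≤ ∑ i, ENNReal.ofReal (‖b i‖ * (‖l i‖ * (η * (L * ‖ur - ul‖)))) := by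
        refine Finset.sum_le_sum fun i _ => ?_
        rw [ENNReal.ofReal_mul (norm_nonneg _), ofReal_norm]
        gcongr
        exact hmain i
    _ = ENNReal.ofReal (K * (η * L) * ‖ur - ul‖) := by
        rw [← ENNReal.ofReal_sum_of_nonneg fun i _ => by positivity, hK, Finset.sum_mul,
          Finset.sum_mul]
        congr 1
        exact Finset.sum_congr rfl fun i _ => by ring
    _ ≤ ENNReal.ofReal (ε * ‖ur - ul‖) := by gcongr

end Linearization

/-! ### The linearized flow on step functions -/

section LinearApprox

variable {n : ℕ} {Ω : Set (State n)} {f : State n → State n} {D : Set (ℝ → State n)}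
  {S : ℝ → (ℝ → State n) → ℝ → State n}

theorem lOneDist_stepFun_le {ι : Type} [Fintype ι] (c : State n) (x x' : ι → ℝ)
    (r : ι → State n) : lOneDist (stepFun c x r) (stepFun c x' r) ≤
      ∑ p, ‖r p‖ₑ * ENNReal.ofReal |x p - x' p| := by
  have hpt : ∀ y, ‖stepFun c x r y - stepFun c x' r y‖ₑ ≤
      ∑ p, (Ico (min (x p) (x' p)) (max (x p) (x' p))).indicator (fun _ => ‖r p‖ₑ) y := by
    intro y
    unfold stepFun
    rw [add_sub_add_left_eq_sub, ← Finset.sum_sub_distrib]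
    refine (enorm_sum_le _ _).trans (Finset.sum_le_sum fun p _ => ?_)
    by_cases h1 : x p ≤ y <;> by_cases h2 : x' p ≤ y
    · simp [h1, h2]
    · simp [h1, h2, not_le.1 h2]
    · simp [h1, h2, not_le.1 h1]
    · simp [h1, h2]
  refine (lintegral_mono hpt).trans ?_
  rw [lintegral_finsetSum _ fun p _ => measurable_const.indicator measurableSet_Ico]
  refine Finset.sum_le_sum fun p _ => ?_
  rw [lintegral_indicator measurableSet_Ico, setLIntegral_const, Real.volume_Ico,
    max_sub_min_eq_abs']

/-- The local error of the superposition of the solutions of the linearized Riemann problems. -/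
theorem GeneratesSRS.exists_local_error (hf : GeneratesSRS Ω f D S) {u₀ : State n}
    (hu₀ : u₀ ∈ Ω) {ε : ℝ} (hε : 0 < ε) : ∃ δ > 0, ∀ {ι : Type} [Fintype ι] (c : State n)
      (x σ : ι → ℝ) (r : ι → State n), (∀ p, fderiv ℝ f u₀ (r p) = σ p • r p) →
      ‖c - u₀‖ ≤ δ → ∑ p, ‖r p‖ ≤ δ → stepFun c x r ∈ D ∧
      ∀ᶠ θ in 𝓝[>] (0 : ℝ),
        lOneDist (stepFun c (fun p => x p + σ p * θ) r) (S θ (stepFun c x r)) ≤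
          ENNReal.ofReal θ * ENNReal.ofReal (ε * ∑ p, ‖r p‖) := by
  obtain ⟨δ₁, hδ₁, h1⟩ := hf.exists_riemann_linear_approx hu₀ hε
  obtain ⟨δ₂, hδ₂, h2⟩ := hf.domain.exists_stepFun_mem hf.isOpen hu₀
  obtain ⟨lam, hlam⟩ := hf.exists_isSpeedBound
  refine ⟨min (δ₁ / 2) δ₂, by positivity, fun {ι} _ c x σ r hr hc hsum => ?_⟩
  have hmem : stepFun c x r ∈ D :=
    h2 c x r (hc.trans (min_le_right _ _)) (hsum.trans (min_le_right _ _))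
  refine ⟨hmem, ?_⟩
  -- Large enough for the cones of opening `Λ` to contain the linear waves as well.
  set Λ : ℝ := |lam| + ∑ p, |σ p| with hΛ
  have hsp := hlam Λ ((le_abs_self _).trans (le_add_of_nonneg_right
    (Finset.sum_nonneg fun p _ => abs_nonneg _)))
  have hσΛ : ∀ p, |σ p| ≤ Λ := fun p =>
    (Finset.single_le_sum (f := fun p => |σ p|) (fun p _ => abs_nonneg _)
      (Finset.mem_univ p)).trans (le_add_of_nonneg_left (abs_nonneg _))
  have hev : ∀ᶠ θ in 𝓝[>] (0 : ℝ), ∀ p q, x p < x q → 2 * Λ * θ < x q - x p := by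
    refine eventually_all.2 fun p => eventually_all.2 fun q => ?_
    by_cases h : x p < x q
    · have hcont : Tendsto (fun θ : ℝ => 2 * Λ * θ) (𝓝 0) (𝓝 (2 * Λ * 0)) :=
        tendsto_id.const_mul _
      rw [mul_zero] at hcont
      filter_upwards [nhdsWithin_le_nhds (hcont.eventually_lt_const (sub_pos.2 h))] with θ hθ _
        using hθ
    · exact Eventually.of_forall fun θ h' => absurd h' h
  filter_upwards [hev, self_mem_nhdsWithin] with θ hsep hθ
  have hθ : 0 < θ := hθ
  -- All waves issuing from the same point `ξ` solve one Riemann problem, so the errors are summed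
  -- over the image of `x` and not over the indices.
  set F : ℝ → ℝ → ℝ≥0∞ := fun ξ z =>
    ‖S 1 (riemannDatum (stepFunLeft c x r ξ) (stepFun c x r ξ)) z -
      (stepFunLeft c x r ξ + ∑ p with x p = ξ, if σ p ≤ z then r p else 0)‖ₑ with hF
  have hrd : ∀ ξ ∈ Finset.univ.image x,
      riemannDatum (stepFunLeft c x r ξ) (stepFun c x r ξ) ∈ D := by
    intro ξ hξ
    obtain ⟨p, -, rfl⟩ := Finset.mem_image.1 hξ
    exact (hsp.near_jump hmem hθ hsep p (x p) (by simpa using (mul_pos hsp.pos hθ).le)).1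
  have hpt : ∀ y, ‖stepFun c (fun p => x p + σ p * θ) r y - S θ (stepFun c x r) y‖ₑ
      ≤ ∑ ξ ∈ Finset.univ.image x, F ξ ((y - ξ) / θ) := by
    intro y
    have hσθ : ∀ p, |σ p * θ| ≤ Λ * θ := fun p => by
      rw [abs_mul, abs_of_pos hθ]
      exact mul_le_mul_of_nonneg_right (hσΛ p) hθ.le
    by_cases h : ∃ p, |y - x p| ≤ Λ * θ
    · obtain ⟨p, hp⟩ := h
      refine le_trans (le_of_eq ?_) (Finset.single_le_sum (f := fun ξ => F ξ ((y - ξ) / θ))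
        (fun _ _ => zero_le) (Finset.mem_image_of_mem x (Finset.mem_univ p)))
      simp only [hF]
      rw [← enorm_neg, neg_sub, (hsp.near_jump hmem hθ hsep p y hp).2]
      congr 2
      unfold stepFun stepFunLeft
      rw [add_assoc, Finset.sum_filter, ← Finset.sum_add_distrib]
      congr 1
      refine Finset.sum_congr rfl fun q _ => ?_
      have hq := abs_le.1 (hσθ q)
      have hp' := abs_le.1 hp
      rcases lt_trichotomy (x q) (x p) with hlt | heq | hgt
      · have := hsep q p hlt
        rw [if_pos (by linarith), if_pos hlt, if_neg hlt.ne, add_zero]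
      · rw [if_neg heq.not_lt, if_pos heq, zero_add, ← heq]
        have : x q + σ q * θ ≤ y ↔ σ q ≤ (y - x q) / θ := by
          rw [le_div_iff₀ hθ, le_sub_iff_add_le, add_comm]
        simp only [this]
      · have := hsep p q hgt
        rw [if_neg (by linarith), if_neg hgt.not_gt, if_neg hgt.ne', add_zero]
    · push Not at h
      rw [hsp.off_jumps hmem hθ hsep y h]
      have : stepFun c (fun p => x p + σ p * θ) r y = stepFun c x r y := by
        unfold stepFun
        congr 1
        refine Finset.sum_congr rfl fun q _ => ?_
        have hq := abs_le.1 (hσθ q)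
        have : x q + σ q * θ ≤ y ↔ x q ≤ y := by
          rcases lt_abs.1 (h q) with h' | h'
          · exact ⟨fun _ => by linarith [mul_pos hsp.pos hθ], fun _ => by linarith⟩
          · exact ⟨fun _ => by linarith, fun _ => by linarith [mul_pos hsp.pos hθ]⟩
        simp only [this]
      rw [this, sub_self, enorm_zero]
      exact zero_le
  refine (lintegral_mono hpt).trans ?_
  have hFm : ∀ ξ ∈ Finset.univ.image x, Measurable fun y => F ξ ((y - ξ) / θ) := by
    intro ξ hξ
    have h3 := hf.domain.measurable (hf.mapsTo 1 zero_le_one _ (hrd ξ hξ))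
    have h4 : Measurable fun z => stepFunLeft c x r ξ + ∑ p with x p = ξ,
        if σ p ≤ z then r p else 0 := measurable_const.add <| Finset.measurable_sum _ fun p _ =>
      Measurable.ite measurableSet_Ici measurable_const measurable_const
    exact (h3.sub h4).enorm.comp ((measurable_id.sub_const ξ).div_const θ)
  rw [lintegral_finsetSum _ hFm]
  have hnorm : ∀ v : State n, ‖v - c‖ ≤ ∑ p, ‖r p‖ → ‖v - u₀‖ ≤ δ₁ := fun v hv => by
    rw [← sub_add_sub_cancel v c u₀]
    refine (norm_add_le _ _).trans ?_
    linarith [min_le_left (δ₁ / 2) δ₂]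
  calc ∑ ξ ∈ Finset.univ.image x, ∫⁻ y, F ξ ((y - ξ) / θ)
      ≤ ∑ ξ ∈ Finset.univ.image x,
        ENNReal.ofReal θ * ENNReal.ofReal (ε * ∑ p with x p = ξ, ‖r p‖) := by
        refine Finset.sum_le_sum fun ξ hξ => ?_
        rw [lintegral_comp_sub_div (F ξ) ξ hθ]
        gcongr
        refine (h1 _ _ (hnorm _ (norm_stepFunLeft_sub_le ξ)) (hnorm _ (norm_stepFun_sub_le ξ))
          (hrd ξ hξ) _ σ r hr (stepFun_sub_stepFunLeft ξ).symm).trans ?_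
        rw [stepFun_sub_stepFunLeft]
        gcongr
        exact norm_sum_le _ _
    _ = ENNReal.ofReal θ * ENNReal.ofReal (ε * ∑ p, ‖r p‖) := by
        rw [← Finset.mul_sum, ← ENNReal.ofReal_sum_of_nonneg fun ξ _ => by positivity,
          ← Finset.mul_sum, Finset.sum_fiberwise_of_maps_to fun p _ =>
            Finset.mem_image_of_mem x (Finset.mem_univ p)]

/-- On step functions with small jumps, the semigroup is close to the semigroup of the linearized
system. -/
theorem GeneratesSRS.exists_linear_approx (hf : GeneratesSRS Ω f D S) {u₀ : State n}
    (hu₀ : u₀ ∈ Ω) {ε : ℝ} (hε : 0 < ε) : ∃ δ > 0, ∀ {ι : Type} [Fintype ι] (c : State n)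
      (x σ : ι → ℝ) (r : ι → State n), (∀ p, fderiv ℝ f u₀ (r p) = σ p • r p) →
      ‖c - u₀‖ ≤ δ → ∑ p, ‖r p‖ ≤ δ → stepFun c x r ∈ D ∧ ∀ h, 0 ≤ h →
        lOneDist (stepFun c (fun p => x p + σ p * h) r) (S h (stepFun c x r)) ≤
          ENNReal.ofReal (h * (ε * ∑ p, ‖r p‖)) := by
  obtain ⟨L, hL⟩ := hf.lipschitz
  have hL0 : (0 : ℝ) < L := hL.1
  -- Division by `L` compensates for the factor in the error formula.
  obtain ⟨δ, hδ, hloc⟩ := hf.exists_local_error hu₀ (div_pos hε hL0)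
  refine ⟨δ, hδ, fun {ι} _ c x σ r hr hc hsum => ⟨(hloc c x σ r hr hc hsum).1, fun h hh => ?_⟩⟩
  -- The curve is the linear flow. Neither `c` nor the jumps `r` change along it, so the smallness
  -- conditions persist after waves cross and the local error estimate applies at every `s`,
  -- although its range of `θ` depends on `s`.
  have key := lOneDist_semigroup_le_lintegral (fun u hu => hf.domain.measurable hu)
    hf.mapsTo hf.zero hf.add hL (w := fun s => stepFun c (fun p => x p + σ p * s) r) hh
    (fun s _ => (hloc c _ σ r hr hc hsum).1) (∑ p, ‖r p‖₊ * ‖σ p‖₊) (fun s _ s' _ => ?_)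
    (fun _ => ENNReal.ofReal (ε / L * ∑ p, ‖r p‖)) (fun s _ κ hκ => ?_)
  · simp only [mul_zero, add_zero] at key
    refine key.trans (le_of_eq ?_)
    rw [setLIntegral_const, Real.volume_Ioc, ← ENNReal.ofReal_mul (by positivity),
      ← ENNReal.ofReal_coe_nnreal, ← ENNReal.ofReal_mul hL0.le]
    congr 1
    field_simp
    ring
  · refine (lOneDist_stepFun_le c _ _ r).trans (le_of_eq ?_)
    push_cast
    rw [Finset.sum_mul]
    refine Finset.sum_congr rfl fun p _ => ?_
    have : x p + σ p * s - (x p + σ p * s') = σ p * (s - s') := by ring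
    rw [this, abs_mul, ENNReal.ofReal_mul (abs_nonneg _), ← Real.enorm_eq_ofReal_abs, mul_assoc]
    rfl
  · filter_upwards [(hloc c (fun p => x p + σ p * s) σ r hr hc hsum).2] with θ hθ
    have : (fun p => x p + σ p * (s + θ)) = fun p => x p + σ p * s + σ p * θ := by
      funext p; ring
    simp only [this]
    refine hθ.trans ?_
    gcongr
    exact le_self_add

end LinearApprox

/-! ### Comparison of the two linearized flows -/

section Comparison

variable {n : ℕ} {Ω : Set (State n)} {f g : State n → State n} {Df Dg : Set (ℝ → State n)}
  {Sf Sg : ℝ → (ℝ → State n) → ℝ → State n}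

theorem lOneDist_riemannDatum_le_riemannDist {ul ur : State n} (hne : ul ≠ ur)
    (h : riemannDatum ul ur ∈ Dg) :
    lOneDist (Sf 1 (riemannDatum ul ur)) (Sg 1 (riemannDatum ul ur)) ≤
      riemannDist Dg Sf Sg * ‖ur - ul‖ₑ := by
  have h0 : ‖ur - ul‖ₑ ≠ 0 := by simpa [sub_eq_zero] using hne.symm
  rw [← ENNReal.div_le_iff h0 enorm_ne_top]
  unfold riemannDist
  exact le_iSup_of_le ul (le_iSup_of_le ur (le_iSup_of_le hne (le_iSup_of_le h le_rfl)))

/-- The solution with initial jump `r` at the origin, at time `1`, of the linear system with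
eigenvectors `b` and eigenvalues `μ`. -/
noncomputable def linearWave (b : Module.Basis (Fin n) ℝ (State n)) (μ : Fin n → ℝ) (r : State n) :
    ℝ → State n :=
  fun ξ => ∑ i, if μ i ≤ ξ then b.repr r i • b i else 0

theorem measurable_linearWave (b : Module.Basis (Fin n) ℝ (State n)) (μ : Fin n → ℝ)
    (r : State n) : Measurable (linearWave b μ r) :=
  Finset.measurable_sum _ fun _ _ =>
    Measurable.ite measurableSet_Ici measurable_const measurable_const

theorem linearWave_smul (b : Module.Basis (Fin n) ℝ (State n)) (μ : Fin n → ℝ) (τ : ℝ)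
    (r : State n) (ξ : ℝ) : linearWave b μ (τ • r) ξ = τ • linearWave b μ r ξ := by
  simp [linearWave, Finset.smul_sum, smul_smul]

/-- The Riemann problems of the linearized systems are at distance at most `d̂(f, g)`. -/
theorem lOneDist_linearWave_le (hf : GeneratesSRS Ω f Df Sf) (hg : GeneratesSRS Ω g Dg Sg)
    (hD : Dg ⊆ Df) {d : ℝ≥0} (hd : riemannDist Dg Sf Sg ≤ d) {u₀ : State n} (hu₀ : u₀ ∈ Ω)
    {bf bg : Module.Basis (Fin n) ℝ (State n)} {μf μg : Fin n → ℝ}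
    (hbf : ∀ i, fderiv ℝ f u₀ (bf i) = μf i • bf i)
    (hbg : ∀ i, fderiv ℝ g u₀ (bg i) = μg i • bg i) (r : State n) :
    lOneDist (linearWave bf μf r) (linearWave bg μg r) ≤ ENNReal.ofReal (d * ‖r‖) := by
  rcases eq_or_ne r 0 with rfl | hr
  · simp [lOneDist, linearWave]
  have hr0 : 0 < ‖r‖ := norm_pos_iff.2 hr
  have key : ∀ ε : ℝ, 0 < ε → lOneDist (linearWave bf μf r) (linearWave bg μg r) ≤
      ENNReal.ofReal ((d + 2 * ε) * ‖r‖) := by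
    intro ε hε
    obtain ⟨δ₁, hδ₁, h1⟩ := hf.exists_riemann_linear_approx hu₀ hε
    obtain ⟨δ₂, hδ₂, h2⟩ := hg.exists_riemann_linear_approx hu₀ hε
    obtain ⟨δ₃, hδ₃, h3⟩ := hg.domain.exists_stepFun_mem hg.isOpen hu₀
    -- Linear waves are homogeneous in `r`, so `r` may be rescaled until its nonlinear Riemann
    -- problem is nearly linear for both fluxes; `τ` depends on `ε` but cancels in the end.
    set τ : ℝ := min δ₁ (min δ₂ δ₃) / ‖r‖ with hτ
    have hτ0 : 0 < τ := by positivity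
    have hτr : ‖τ • r‖ = min δ₁ (min δ₂ δ₃) := by
      rw [norm_smul, Real.norm_of_nonneg hτ0.le, hτ, div_mul_cancel₀ _ hr0.ne']
    have hmem : riemannDatum u₀ (u₀ + τ • r) ∈ Dg := by
      rw [riemannDatum_eq_stepFun]
      refine h3 _ _ _ (by simpa using hδ₃.le) ?_
      simp [hτr]
    have hne : u₀ ≠ u₀ + τ • r := by simp [hτ0.ne', hr]
    have hwave : ∀ {b : Module.Basis (Fin n) ℝ (State n)}, ∑ i, b.repr (τ • r) i • b i
        = u₀ + τ • r - u₀ := fun {b} => by rw [b.sum_repr, add_sub_cancel_left]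
    have h1' := h1 u₀ (u₀ + τ • r) (by simpa using hδ₁.le) (by
      rw [add_sub_cancel_left, hτr]; exact min_le_left _ _) (hD hmem) Finset.univ μf
      (fun i => bf.repr (τ • r) i • bf i) (fun i => by rw [map_smul, hbf, smul_comm]) hwave
    have h2' := h2 u₀ (u₀ + τ • r) (by simpa using hδ₂.le) (by
      rw [add_sub_cancel_left, hτr]; exact (min_le_right _ _).trans (min_le_left _ _)) hmem
      Finset.univ μg (fun i => bg.repr (τ • r) i • bg i)
      (fun i => by rw [map_smul, hbg, smul_comm]) hwave
    have h3' := (lOneDist_riemannDatum_le_riemannDist (Sf := Sf) (Sg := Sg) hne hmem).trans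
      (mul_le_mul_left hd _)
    have hmf := hf.domain.measurable (hf.mapsTo 1 zero_le_one _ (hD hmem))
    have hmg := hg.domain.measurable (hg.mapsTo 1 zero_le_one _ hmem)
    have hwf : Measurable fun ξ => u₀ + linearWave bf μf (τ • r) ξ :=
      (measurable_linearWave _ _ _).const_add _
    have htri := (lOneDist_triangle hwf hmf fun ξ => u₀ + linearWave bg μg (τ • r) ξ).trans
      (add_le_add_right (lOneDist_triangle hmf hmg _) _)
    rw [lOneDist_comm _ (Sf 1 _)] at htri
    replace htri := htri.trans (add_le_add h1' (add_le_add h3' h2'))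
    have hl : lOneDist (fun ξ => u₀ + linearWave bf μf (τ • r) ξ)
        (fun ξ => u₀ + linearWave bg μg (τ • r) ξ) =
        ENNReal.ofReal τ * lOneDist (linearWave bf μf r) (linearWave bg μg r) := by
      unfold lOneDist
      rw [← lintegral_const_mul' _ _ ENNReal.ofReal_ne_top]
      refine lintegral_congr fun ξ => ?_
      rw [add_sub_add_left_eq_sub, linearWave_smul, linearWave_smul, ← smul_sub, enorm_smul,
        Real.enorm_eq_ofReal hτ0.le]
    have hrr : ENNReal.ofReal (ε * ‖u₀ + τ • r - u₀‖) + (d * ‖u₀ + τ • r - u₀‖ₑ +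
        ENNReal.ofReal (ε * ‖u₀ + τ • r - u₀‖)) =
        ENNReal.ofReal τ * ENNReal.ofReal ((d + 2 * ε) * ‖r‖) := by
      rw [add_sub_cancel_left, ← ofReal_norm, norm_smul, Real.norm_of_nonneg hτ0.le,
        ← ENNReal.ofReal_coe_nnreal, ← ENNReal.ofReal_mul (by positivity),
        ← ENNReal.ofReal_add (by positivity) (by positivity),
        ← ENNReal.ofReal_add (by positivity) (by positivity), ← ENNReal.ofReal_mul hτ0.le]
      congr 1
      ring
    rw [hl, hrr] at htri
    exact (ENNReal.mul_le_mul_iff_right (ENNReal.ofReal_pos.2 hτ0).ne' ENNReal.ofReal_ne_top).1 htri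
  have hlim : Tendsto (fun ε : ℝ => ENNReal.ofReal ((d + 2 * ε) * ‖r‖)) (𝓝[>] 0)
      (𝓝 (ENNReal.ofReal ((d + 2 * 0) * ‖r‖))) :=
    ((ENNReal.continuous_ofReal.comp (by fun_prop)).tendsto 0).mono_left nhdsWithin_le_nhds
  rw [mul_zero, add_zero] at hlim
  exact ge_of_tendsto hlim (eventually_mem_nhdsWithin.mono fun ε hε => key ε hε)

/-- Each jump becomes `n` eigenvector jumps at the same point, which the linear flow then separates.
-/
theorem stepFun_eq_stepFun_prod {ι : Type} [Fintype ι] (b : Module.Basis (Fin n) ℝ (State n))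
    (c : State n) (x : ι → ℝ) (r : ι → State n) :
    stepFun c x r = stepFun (ι := ι × Fin n) c (fun p => x p.1)
      (fun p => b.repr (r p.1) p.2 • b p.2) := by
  funext y
  unfold stepFun
  rw [Fintype.sum_prod_type]
  congr 1
  refine Finset.sum_congr rfl fun p _ => ?_
  by_cases h : x p ≤ y
  · simp [h, b.sum_repr]
  · simp [h]

/-- The price of splitting jumps into eigenvectors. It enters only the smallness thresholds and the
`ε` terms, so it does not spoil the constant `d`. -/
theorem exists_sum_norm_repr_smul_le (b : Module.Basis (Fin n) ℝ (State n)) :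
    ∃ K : ℝ, 0 < K ∧ ∀ {ι : Type} [Fintype ι] (r : ι → State n),
      ∑ p : ι × Fin n, ‖b.repr (r p.1) p.2 • b p.2‖ ≤ K * ∑ p, ‖r p‖ := by
  let l : Fin n → State n →L[ℝ] ℝ := fun i => LinearMap.toContinuousLinearMap (b.coord i)
  refine ⟨(∑ i, ‖l i‖ * ‖b i‖) + 1, by positivity, fun r => ?_⟩
  rw [Fintype.sum_prod_type, Finset.mul_sum]
  refine Finset.sum_le_sum fun p _ => ?_
  have : ∑ i, ‖b.repr (r p) i • b i‖ ≤ (∑ i, ‖l i‖ * ‖b i‖) * ‖r p‖ := by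
    rw [Finset.sum_mul]
    refine Finset.sum_le_sum fun i _ => ?_
    rw [norm_smul, mul_right_comm]
    gcongr
    exact (l i).le_opNorm (r p)
  refine this.trans ?_
  gcongr
  linarith

/-- The two semigroups on step functions with small jumps. -/
theorem exists_lOneDist_semigroup_stepFun_le (hf : GeneratesSRS Ω f Df Sf)
    (hg : GeneratesSRS Ω g Dg Sg) (hD : Dg ⊆ Df) {d : ℝ≥0} (hd : riemannDist Dg Sf Sg ≤ d)
    {u₀ : State n} (hu₀ : u₀ ∈ Ω) {ε : ℝ} (hε : 0 < ε) :
    ∃ δ > 0, ∀ {ι : Type} [Fintype ι] (c : State n) (x : ι → ℝ) (r : ι → State n),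
      ‖c - u₀‖ ≤ δ → ∑ p, ‖r p‖ ≤ δ → stepFun c x r ∈ Dg ∧ ∀ h, 0 < h →
        lOneDist (Sf h (stepFun c x r)) (Sg h (stepFun c x r)) ≤
          ENNReal.ofReal (h * ((d + ε) * ∑ p, ‖r p‖)) := by
  obtain ⟨bf, μf, hbf⟩ := hf.hyperbolic u₀ hu₀
  obtain ⟨bg, μg, hbg⟩ := hg.hyperbolic u₀ hu₀
  obtain ⟨Kf, hKf, hKf'⟩ := exists_sum_norm_repr_smul_le bf
  obtain ⟨Kg, hKg, hKg'⟩ := exists_sum_norm_repr_smul_le bg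
  obtain ⟨δf, hδf, h1⟩ := hf.exists_linear_approx hu₀ (show 0 < ε / 2 / Kf by positivity)
  obtain ⟨δg, hδg, h2⟩ := hg.exists_linear_approx hu₀ (show 0 < ε / 2 / Kg by positivity)
  refine ⟨min (min δf (δf / Kf)) (min δg (δg / Kg)), by positivity,
    fun {ι} _ c x r hc hsum => ?_⟩
  have hf1 := h1 (ι := ι × Fin n) c (fun p => x p.1) (fun p => μf p.2)
    (fun p => bf.repr (r p.1) p.2 • bf p.2) (fun p => by rw [map_smul, hbf, smul_comm])
    (hc.trans ((min_le_left _ _).trans (min_le_left _ _)))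
    ((hKf' r).trans
      ((le_div_iff₀' hKf).1 (hsum.trans ((min_le_left _ _).trans (min_le_right _ _)))))
  have hg1 := h2 (ι := ι × Fin n) c (fun p => x p.1) (fun p => μg p.2)
    (fun p => bg.repr (r p.1) p.2 • bg p.2) (fun p => by rw [map_smul, hbg, smul_comm])
    (hc.trans ((min_le_right _ _).trans (min_le_left _ _)))
    ((hKg' r).trans
      ((le_div_iff₀' hKg).1 (hsum.trans ((min_le_right _ _).trans (min_le_right _ _)))))
  rw [← stepFun_eq_stepFun_prod] at hf1 hg1
  refine ⟨hg1.1, fun h hh => ?_⟩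
  have hmf := hf.domain.measurable (hf.mapsTo h hh.le _ hf1.1)
  -- Linear solutions are superpositions of self-similar waves, one for each unsplit jump `r p`;
  -- each costs `h d ‖r p‖`, whatever the spacing of the jumps.
  have hlin : lOneDist
      (stepFun (ι := ι × Fin n) c (fun p => x p.1 + μf p.2 * h)
        (fun p => bf.repr (r p.1) p.2 • bf p.2))
      (stepFun (ι := ι × Fin n) c (fun p => x p.1 + μg p.2 * h)
        (fun p => bg.repr (r p.1) p.2 • bg p.2)) ≤ ENNReal.ofReal (h * (d * ∑ p, ‖r p‖)) := by
    have heq : ∀ (b : Module.Basis (Fin n) ℝ (State n)) (μ : Fin n → ℝ) y,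
        stepFun (ι := ι × Fin n) c (fun p => x p.1 + μ p.2 * h)
          (fun p => b.repr (r p.1) p.2 • b p.2) y
          = c + ∑ p, linearWave b μ (r p) ((y - x p) / h) := by
      intro b μ y
      unfold stepFun linearWave
      rw [Fintype.sum_prod_type]
      congr 1
      refine Finset.sum_congr rfl fun p _ => Finset.sum_congr rfl fun i _ => ?_
      have : x p + μ i * h ≤ y ↔ μ i ≤ (y - x p) / h := by
        rw [le_div_iff₀ hh, le_sub_iff_add_le, add_comm]
      simp only [this]
    unfold lOneDist
    simp only [heq, add_sub_add_left_eq_sub, ← Finset.sum_sub_distrib]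
    calc ∫⁻ y, ‖∑ p, (linearWave bf μf (r p) ((y - x p) / h)
          - linearWave bg μg (r p) ((y - x p) / h))‖ₑ
        ≤ ∫⁻ y, ∑ p, ‖linearWave bf μf (r p) ((y - x p) / h)
          - linearWave bg μg (r p) ((y - x p) / h)‖ₑ := lintegral_mono fun y => enorm_sum_le _ _
      _ = ∑ p, ∫⁻ y, ‖linearWave bf μf (r p) ((y - x p) / h)
          - linearWave bg μg (r p) ((y - x p) / h)‖ₑ :=
          lintegral_finsetSum _ fun p _ => ((measurable_linearWave bf μf (r p)).sub
            (measurable_linearWave bg μg (r p))).enorm.comp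
              ((measurable_id.sub_const (x p)).div_const h)
      _ ≤ ∑ p, ENNReal.ofReal (h * (d * ‖r p‖)) := by
          refine Finset.sum_le_sum fun p _ => ?_
          rw [lintegral_comp_sub_div (fun z => ‖linearWave bf μf (r p) z
            - linearWave bg μg (r p) z‖ₑ) (x p) hh, ENNReal.ofReal_mul hh.le]
          gcongr
          exact lOneDist_linearWave_le hf hg hD hd hu₀ hbf hbg (r p)
      _ = ENNReal.ofReal (h * (d * ∑ p, ‖r p‖)) := by
          rw [← ENNReal.ofReal_sum_of_nonneg fun p _ => by positivity, Finset.mul_sum,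
            Finset.mul_sum]
  have hf2 := hf1.2 h hh.le
  have hg2 := hg1.2 h hh.le
  rw [lOneDist_comm] at hf2
  refine ((lOneDist_triangle hmf measurable_stepFun _).trans (add_le_add hf2
    ((lOneDist_triangle measurable_stepFun measurable_stepFun _).trans
      (add_le_add hlin hg2)))).trans ?_
  rw [← ENNReal.ofReal_add (by positivity) (by positivity),
    ← ENNReal.ofReal_add (by positivity) (by positivity)]
  refine ENNReal.ofReal_le_ofReal ?_
  have e1 : ε / 2 / Kf * ∑ p : ι × Fin n, ‖bf.repr (r p.1) p.2 • bf p.2‖ ≤ ε / 2 * ∑ p, ‖r p‖ := by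
    rw [div_mul_eq_mul_div, div_le_iff₀ hKf]
    have := mul_le_mul_of_nonneg_left (hKf' r) (show 0 ≤ ε / 2 by positivity)
    linarith
  have e2 : ε / 2 / Kg * ∑ p : ι × Fin n, ‖bg.repr (r p.1) p.2 • bg p.2‖ ≤ ε / 2 * ∑ p, ‖r p‖ := by
    rw [div_mul_eq_mul_div, div_le_iff₀ hKg]
    have := mul_le_mul_of_nonneg_left (hKg' r) (show 0 ≤ ε / 2 by positivity)
    linarith
  rw [← mul_add, ← mul_add]
  refine mul_le_mul_of_nonneg_left ?_ hh.le
  linarith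

end Comparison

/-! ### Truncation and sampling of BV functions -/

section Sampling

variable {n : ℕ}

/-- The function that agrees with `v` on `[a, b]` and is constant on both sides. -/
noncomputable def clamp (a b : ℝ) (v : ℝ → State n) : ℝ → State n :=
  v ∘ fun x => max a (min x b)

theorem clamp_of_mem {a b : ℝ} {v : ℝ → State n} {x : ℝ} (hx : x ∈ Icc a b) :
    clamp a b v x = v x := by
  simp [clamp, hx.1, hx.2]

theorem clamp_of_le {a b : ℝ} {v : ℝ → State n} {x : ℝ} (hx : x ≤ a) :
    clamp a b v x = v a := by
  simp [clamp, hx]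

theorem clamp_of_ge {a b : ℝ} (hab : a ≤ b) {v : ℝ → State n} {x : ℝ} (hx : b ≤ x) :
    clamp a b v x = v b := by
  simp [clamp, hx, hab]

theorem IsSRSDomain.clamp_mem {Ω : Set (State n)} {D : Set (ℝ → State n)} (hD : IsSRSDomain Ω D)
    {v : ℝ → State n} (hv : v ∈ D) (a b : ℝ) : clamp a b v ∈ D := by
  refine hD.sampling v hv _ (fun x y hxy => by gcongr)
    (fun x => Continuous.continuousWithinAt (by fun_prop)) ⟨a, b, fun x hx => ?_, fun x hx => ?_⟩
  · simp [hx]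
  · simp [hx.le]

theorem sum_range_ite_sub_eq {E : Type*} [AddCommGroup E] (v : ℝ → E) {p : ℕ → ℝ} {z : ℝ}
    {k N : ℕ} (hk : k ≤ N) (h1 : ∀ j < k, p (j + 1) ≤ z) (h2 : ∀ j, k ≤ j → j < N → z < p (j + 1)) :
    ∑ j ∈ Finset.range N, (if p (j + 1) ≤ z then v (p (j + 1)) - v (p j) else 0)
      = v (p k) - v (p 0) := by
  rw [← Finset.sum_range_sub (fun j => v (p j)), ← Finset.sum_subset (Finset.range_mono hk)]
  · exact Finset.sum_congr rfl fun j hj => if_pos (h1 j (Finset.mem_range.1 hj))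
  · intro j hj hj'
    rw [Finset.mem_range] at hj hj'
    exact if_neg (h2 j (not_lt.1 hj') hj).not_ge

/-- A function of bounded variation is approximated in `L¹` by step functions with no larger
variation. -/
theorem exists_stepFun_lOneDist_clamp_le {v : ℝ → State n} (hv : BoundedVariationOn v univ)
    {a b : ℝ} (hab : a ≤ b) (N : ℕ) : ∃ (x : Fin (N + 1) → ℝ) (r : Fin (N + 1) → State n),
      ∑ p, ‖r p‖ ≤ varFun v b - varFun v a ∧
      lOneDist (clamp a b v) (stepFun (v a) x r) ≤
        ENNReal.ofReal ((b - a) / (N + 1) * (varFun v b - varFun v a)) := by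
  have hN : (0 : ℝ) < N + 1 := by positivity
  set m := (b - a) / ((N : ℝ) + 1) with hm
  have hm0 : 0 ≤ m := div_nonneg (by linarith) hN.le
  set p : ℕ → ℝ := fun j => a + m * j with hp
  have hp0 : p 0 = a := by simp [hp]
  have hpN : p (N + 1) = b := by
    simp only [hp, hm]; push_cast
    field_simp
    ring
  have hstep : ∀ j, p (j + 1) - p j = m := fun j => by simp only [hp]; push_cast; ring
  have hmono : Monotone p := monotone_nat_of_le_succ fun j => by linarith [hstep j]
  have hV := hv.monotone_varFun
  have htele : ∑ j ∈ Finset.range (N + 1), (varFun v (p (j + 1)) - varFun v (p j))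
      = varFun v b - varFun v a := by
    rw [Finset.sum_range_sub fun j => varFun v (p j), hp0, hpN]
  -- On `[p j, p (j + 1))` the step function has the value `v (p j)`; on each cell the error is at
  -- most the variation of `v` there.
  refine ⟨fun j => p (j + 1), fun j => v (p (j + 1)) - v (p j), ?_, ?_⟩
  · rw [Fin.sum_univ_eq_sum_range fun j => ‖v (p (j + 1)) - v (p j)‖, ← htele]
    refine Finset.sum_le_sum fun j _ => ?_
    rw [← dist_eq_norm]
    exact hv.dist_le_varFun_sub (hmono j.le_succ)
  have hstepFun : ∀ z, stepFun (v a) (fun j : Fin (N + 1) => p (j + 1))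
      (fun j => v (p (j + 1)) - v (p j)) z = v a + ∑ j ∈ Finset.range (N + 1),
        if p (j + 1) ≤ z then v (p (j + 1)) - v (p j) else 0 := fun z => by
    unfold stepFun
    rw [Fin.sum_univ_eq_sum_range fun j => if p (j + 1) ≤ z then v (p (j + 1)) - v (p j) else 0]
  have hpt : ∀ z, ‖clamp a b v z - stepFun (v a) (fun j : Fin (N + 1) => p (j + 1))
      (fun j => v (p (j + 1)) - v (p j)) z‖ₑ ≤ ∑ j ∈ Finset.range (N + 1),
        (Ico (p j) (p (j + 1))).indicator
          (fun _ => ENNReal.ofReal (varFun v (p (j + 1)) - varFun v (p j))) z := by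
    intro z
    rw [hstepFun]
    rcases lt_or_ge z a with hza | hza
    · rw [sum_range_ite_sub_eq v (k := 0) (Nat.zero_le _) (fun j hj => absurd hj (by simp))
        (fun j _ _ => hza.trans_le (hp0 ▸ hmono (Nat.zero_le _))), clamp_of_le hza.le]
      simp
    rcases le_or_gt b z with hzb | hzb
    · rw [sum_range_ite_sub_eq v (k := N + 1) le_rfl (fun j hj => le_trans (hmono hj)
        (hpN ▸ hzb)) (fun j h1 h2 => absurd h2 h1.not_gt), clamp_of_ge hab hzb, hp0, hpN]
      simp
    set k := Nat.findGreatest (fun k => p k ≤ z) (N + 1) with hk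
    have hk1 : p k ≤ z := Nat.findGreatest_spec (P := fun k => p k ≤ z) (Nat.zero_le (N + 1))
      (by rwa [hp0])
    have hkN : k < N + 1 := by
      refine lt_of_le_of_ne (Nat.findGreatest_le _) fun he => ?_
      rw [he, hpN] at hk1
      exact hzb.not_ge hk1
    have hk2 : z < p (k + 1) := not_le.1 fun h =>
      absurd (Nat.le_findGreatest (P := fun k => p k ≤ z) hkN h) (by rw [← hk]; omega)
    rw [sum_range_ite_sub_eq v hkN.le (fun j hj => (hmono hj).trans hk1)
      (fun j hj _ => hk2.trans_le (hmono (by omega))), clamp_of_mem ⟨hza, hzb.le⟩, hp0,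
      add_sub_cancel]
    refine le_trans ?_ (Finset.single_le_sum (f := fun j => (Ico (p j) (p (j + 1))).indicator
          (fun _ => ENNReal.ofReal (varFun v (p (j + 1)) - varFun v (p j))) z)
          (fun _ _ => zero_le) (Finset.mem_range.2 hkN))
    rw [indicator_of_mem (show z ∈ Ico (p k) (p (k + 1)) from ⟨hk1, hk2⟩), ← ofReal_norm,
      ← dist_eq_norm]
    refine ENNReal.ofReal_le_ofReal ((hv.dist_le_varFun_sub hk1).trans ?_)
    linarith [hV hk2.le]
  refine (lintegral_mono hpt).trans ?_
  rw [lintegral_finsetSum _ fun j _ => measurable_const.indicator measurableSet_Ico, ← htele,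
    Finset.mul_sum, ENNReal.ofReal_sum_of_nonneg fun j _ =>
      mul_nonneg hm0 (sub_nonneg.2 (hV (hmono j.le_succ)))]
  refine Finset.sum_le_sum fun j _ => le_of_eq ?_
  rw [lintegral_indicator measurableSet_Ico, setLIntegral_const, Real.volume_Ico, hstep, mul_comm,
    ENNReal.ofReal_mul hm0]

end Sampling

/-! ### Intervals of small variation -/

section LocalEstimates

variable {n : ℕ} {Ω : Set (State n)} {f g : State n → State n} {Df Dg : Set (ℝ → State n)}
  {Sf Sg : ℝ → (ℝ → State n) → ℝ → State n}

theorem IsLipschitzConst.lOneDist_le {D : Set (ℝ → State n)}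
    {S : ℝ → (ℝ → State n) → ℝ → State n} {L : ℝ≥0} (hL : IsLipschitzConst D S L) {t : ℝ}
    (ht : 0 ≤ t) {u w : ℝ → State n} (hu : u ∈ D) (hw : w ∈ D) :
    lOneDist (S t u) (S t w) ≤ L * lOneDist u w := by
  simpa using hL.2 t t ht ht u hu w hw

/-- The distance of the semigroups on `v`, in terms of their distance on an approximation `w`. -/
theorem lOneDist_semigroup_le_of_approx (hf : GeneratesSRS Ω f Df Sf)
    (hg : GeneratesSRS Ω g Dg Sg) (hD : Dg ⊆ Df) {Lf Lg : ℝ≥0} (hLf : IsLipschitzConst Df Sf Lf)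
    (hLg : IsLipschitzConst Dg Sg Lg) {v w : ℝ → State n} (hv : v ∈ Dg) (hw : w ∈ Dg) {h : ℝ}
    (hh : 0 ≤ h) : lOneDist (Sf h v) (Sg h v) ≤
      lOneDist (Sf h w) (Sg h w) + (Lf + Lg) * lOneDist v w := by
  have m1 := hf.domain.measurable (hf.mapsTo h hh _ (hD hv))
  have m2 := hf.domain.measurable (hf.mapsTo h hh _ (hD hw))
  have m3 := hg.domain.measurable (hg.mapsTo h hh _ hw)
  calc lOneDist (Sf h v) (Sg h v)
      ≤ lOneDist (Sf h v) (Sf h w) + (lOneDist (Sf h w) (Sg h w) + lOneDist (Sg h w) (Sg h v)) :=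
        (lOneDist_triangle m1 m2 _).trans (add_le_add_right (lOneDist_triangle m2 m3 _) _)
    _ ≤ Lf * lOneDist v w + (lOneDist (Sf h w) (Sg h w) + Lg * lOneDist w v) := by
        gcongr
        · exact hLf.lOneDist_le hh (hD hv) (hD hw)
        · exact hLg.lOneDist_le hh hw hv
    _ = lOneDist (Sf h w) (Sg h w) + (Lf + Lg) * lOneDist v w := by
        rw [lOneDist_comm w v]; ring

/-- The estimate for step functions holds for every `h > 0`, however close the jumps, so the mesh
can tend to zero with `h` fixed. -/
theorem exists_lOneDist_semigroup_clamp_le (hf : GeneratesSRS Ω f Df Sf)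
    (hg : GeneratesSRS Ω g Dg Sg) (hD : Dg ⊆ Df) {d : ℝ≥0} (hd : riemannDist Dg Sf Sg ≤ d)
    {u₀ : State n} (hu₀ : u₀ ∈ Ω) {ε : ℝ} (hε : 0 < ε) :
    ∃ δ > 0, ∀ v ∈ Dg, ∀ a b, a ≤ b → ‖v a - u₀‖ ≤ δ → varFun v b - varFun v a ≤ δ →
      ∀ h, 0 < h → lOneDist (Sf h (clamp a b v)) (Sg h (clamp a b v)) ≤
        ENNReal.ofReal (h * ((d + ε) * (varFun v b - varFun v a))) := by
  obtain ⟨Lf, hLf⟩ := hf.lipschitz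
  obtain ⟨Lg, hLg⟩ := hg.lipschitz
  obtain ⟨δ, hδ, hstep⟩ := exists_lOneDist_semigroup_stepFun_le hf hg hD hd hu₀ hε
  refine ⟨δ, hδ, fun v hv a b hab hva hvar h hh => ?_⟩
  have hbv := hg.domain.boundedVariation v hv
  have hV0 : 0 ≤ varFun v b - varFun v a := sub_nonneg.2 (hbv.monotone_varFun hab)
  have key : ∀ N : ℕ, lOneDist (Sf h (clamp a b v)) (Sg h (clamp a b v)) ≤
      ENNReal.ofReal (h * ((d + ε) * (varFun v b - varFun v a)) +
        (Lf + Lg) * ((b - a) * (varFun v b - varFun v a)) * (1 / (N + 1))) := by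
    intro N
    obtain ⟨x, r, hr, happ⟩ := exists_stepFun_lOneDist_clamp_le hbv hab N
    obtain ⟨hmem, hdist⟩ := hstep (v a) x r hva (hr.trans hvar)
    refine (lOneDist_semigroup_le_of_approx hf hg hD hLf hLg (hg.domain.clamp_mem hv _ _) hmem
      hh.le).trans ?_
    have hba : 0 ≤ b - a := sub_nonneg.2 hab
    rw [ENNReal.ofReal_add (by positivity) (by positivity)]
    gcongr
    · refine (hdist h hh).trans ?_
      gcongr
    · calc ((Lf : ℝ≥0∞) + Lg) * lOneDist (clamp a b v) (stepFun (v a) x r)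
          ≤ ((Lf : ℝ≥0∞) + Lg) *
              ENNReal.ofReal ((b - a) / (N + 1) * (varFun v b - varFun v a)) := by gcongr
        _ = ENNReal.ofReal ((Lf + Lg) * ((b - a) * (varFun v b - varFun v a)) * (1 / (N + 1))) := by
            rw [← ENNReal.coe_add, ← ENNReal.ofReal_coe_nnreal,
              ← ENNReal.ofReal_mul (by positivity)]
            congr 1
            push_cast
            ring
  have hlim : Tendsto (fun N : ℕ => h * ((d + ε) * (varFun v b - varFun v a)) +
      (Lf + Lg) * ((b - a) * (varFun v b - varFun v a)) * (1 / ((N : ℝ) + 1))) atTop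
      (𝓝 (h * ((d + ε) * (varFun v b - varFun v a)) +
        (Lf + Lg) * ((b - a) * (varFun v b - varFun v a)) * 0)) :=
    (tendsto_one_div_add_atTop_nhds_zero_nat.const_mul _).const_add _
  rw [mul_zero, add_zero] at hlim
  exact ge_of_tendsto' (ENNReal.tendsto_ofReal hlim) key

/-- Compactness makes `δ` independent of the state at which the fluxes are linearized. -/
theorem exists_forall_lOneDist_semigroup_clamp_le (hf : GeneratesSRS Ω f Df Sf)
    (hg : GeneratesSRS Ω g Dg Sg) (hD : Dg ⊆ Df) {d : ℝ≥0} (hd : riemannDist Dg Sf Sg ≤ d)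
    {K : Set (State n)} (hK : IsCompact K) (hKΩ : K ⊆ Ω) {ε : ℝ} (hε : 0 < ε) :
    ∃ δ > 0, ∀ v ∈ Dg, ∀ a b, a ≤ b → v a ∈ K → varFun v b - varFun v a ≤ δ →
      ∀ h, 0 < h → lOneDist (Sf h (clamp a b v)) (Sg h (clamp a b v)) ≤
        ENNReal.ofReal (h * ((d + ε) * (varFun v b - varFun v a))) := by
  let P : Set (State n) → Prop := fun s => ∃ δ > 0, ∀ v ∈ Dg, ∀ a b, a ≤ b → v a ∈ s →
    varFun v b - varFun v a ≤ δ → ∀ h, 0 < h →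
      lOneDist (Sf h (clamp a b v)) (Sg h (clamp a b v)) ≤
        ENNReal.ofReal (h * ((d + ε) * (varFun v b - varFun v a)))
  refine hK.induction_on (p := P) ⟨1, one_pos, by simp⟩ ?_ ?_ ?_
  · rintro s t hst ⟨δ, hδ, H⟩
    exact ⟨δ, hδ, fun v hv a b hab hva => H v hv a b hab (hst hva)⟩
  · rintro s t ⟨δ, hδ, H⟩ ⟨δ', hδ', H'⟩
    refine ⟨min δ δ', lt_min hδ hδ', fun v hv a b hab hva hvar => ?_⟩
    rcases hva with hva | hva
    · exact H v hv a b hab hva (hvar.trans (min_le_left _ _))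
    · exact H' v hv a b hab hva (hvar.trans (min_le_right _ _))
  · intro u₀ hu₀
    obtain ⟨δ, hδ, H⟩ := exists_lOneDist_semigroup_clamp_le hf hg hD hd (hKΩ hu₀) hε
    refine ⟨Metric.closedBall u₀ δ, nhdsWithin_le_nhds (Metric.closedBall_mem_nhds _ hδ), δ, hδ,
      fun v hv a b hab hva => H v hv a b hab ?_⟩
    rwa [← dist_eq_norm]

end LocalEstimates

/-! ### Continuous induction on the line -/

/-- The supremum of the points related to `a` is itself related to `a` by `hleft`, and `hright`
would carry the relation past it if it were below `b`. -/
theorem rel_of_forall_eventually_of_trans {E : ℝ → ℝ → Prop}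
    (htrans : ∀ a b c, a < b → b < c → E a b → E b c → E a c)
    (hright : ∀ x, ∀ᶠ y in 𝓝[>] x, E x y) (hleft : ∀ x, ∀ᶠ y in 𝓝[<] x, E y x) {a b : ℝ}
    (hab : a < b) : E a b := by
  have hright' : ∀ x, x < b → ∃ y ∈ Ioc x b, E x y := fun x hx => by
    obtain ⟨y, h1, h2⟩ := ((hright x).and (Ioc_mem_nhdsGT hx)).exists
    exact ⟨y, h2, h1⟩
  set s := {y | y ∈ Ioc a b ∧ E a y} with hs
  obtain ⟨y₀, hy₀, hE₀⟩ := hright' a hab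
  have hbdd : BddAbove s := ⟨b, fun y hy => hy.1.2⟩
  have hne : s.Nonempty := ⟨y₀, hy₀, hE₀⟩
  have hac : a < sSup s := hy₀.1.trans_le (le_csSup hbdd ⟨hy₀, hE₀⟩)
  have hcb : sSup s ≤ b := csSup_le hne fun y hy => hy.1.2
  have hEc : E a (sSup s) := by
    obtain ⟨l, hl, hlE⟩ := mem_nhdsLT_iff_exists_Ioo_subset.1 (hleft (sSup s))
    obtain ⟨y, hy, hly⟩ := exists_lt_of_lt_csSup hne (show l < sSup s from hl)
    rcases (le_csSup hbdd hy).lt_or_eq with hlt | heq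
    · exact htrans _ _ _ hy.1.1 hlt hy.2 (hlE ⟨hly, hlt⟩)
    · rw [← heq]; exact hy.2
  rcases hcb.lt_or_eq with hlt | heq
  · obtain ⟨y, hy, hE⟩ := hright' _ hlt
    exact absurd (le_csSup hbdd ⟨⟨hac.trans hy.1, hy.2⟩, htrans _ _ _ hac hy.1 hEc hE⟩) hy.1.not_ge
  · rwa [heq] at hEc

/-! ### Windows around a point -/

section Instantaneous

variable {n : ℕ} {Ω : Set (State n)} {f g : State n → State n} {Df Dg : Set (ℝ → State n)}
  {Sf Sg : ℝ → (ℝ → State n) → ℝ → State n}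

theorem GeneratesSRS.apply_const {D : Set (ℝ → State n)}
    {S : ℝ → (ℝ → State n) → ℝ → State n} (hf : GeneratesSRS Ω f D S) {c : State n}
    (hc : (fun _ => c) ∈ D) {t : ℝ} (ht : 0 ≤ t) : S t (fun _ => c) = fun _ => c := by
  rcases ht.eq_or_lt with rfl | ht
  · exact hf.zero _ hc
  obtain ⟨lam, hlam⟩ := hf.exists_isSpeedBound
  have he : stepFun (ι := Empty) c (fun _ => 0) (fun _ => 0) = fun _ => c := by
    funext y; simp [stepFun]
  rw [← he] at hc ⊢
  funext y
  exact (hlam lam le_rfl).off_jumps hc ht (fun p => p.elim) y fun p => p.elim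

theorem lOneDist_semigroup_jump_le (hf : GeneratesSRS Ω f Df Sf) (hg : GeneratesSRS Ω g Dg Sg)
    (hD : Dg ⊆ Df) {d : ℝ≥0} (hd : riemannDist Dg Sf Sg ≤ d) {ul ur : State n}
    (hmem : riemannDatum ul ur ∈ Dg) (x₀ : ℝ) {h : ℝ} (hh : 0 < h) :
    lOneDist (Sf h (jump x₀ ul ur)) (Sg h (jump x₀ ul ur)) ≤
      ENNReal.ofReal (h * (d * ‖ur - ul‖)) := by
  have h1 : lOneDist (Sf h (jump x₀ ul ur)) (Sg h (jump x₀ ul ur)) = ENNReal.ofReal h *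
      lOneDist (Sf 1 (riemannDatum ul ur)) (Sg 1 (riemannDatum ul ur)) := by
    unfold lOneDist
    simp only [hf.apply_jump (hD hmem) x₀ hh, hg.apply_jump hmem x₀ hh]
    exact lintegral_comp_sub_div (fun z => ‖Sf 1 (riemannDatum ul ur) z -
      Sg 1 (riemannDatum ul ur) z‖ₑ) x₀ hh
  rw [h1, ENNReal.ofReal_mul hh.le]
  gcongr
  rcases eq_or_ne ul ur with rfl | hne
  · have hc : riemannDatum ul ul = fun _ => ul := by funext; simp [riemannDatum]
    rw [hc] at hmem ⊢
    rw [hf.apply_const (hD hmem) zero_le_one, hg.apply_const hmem zero_le_one, lOneDist_self]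
    exact zero_le
  · refine (lOneDist_riemannDatum_le_riemannDist hne hmem).trans ?_
    rw [ENNReal.ofReal_mul (by positivity), ofReal_norm, ENNReal.ofReal_coe_nnreal]
    gcongr

/-- The `L¹` distance on the set `s`. -/
noncomputable def lOneDistOn (s : Set ℝ) (u w : ℝ → State n) : ℝ≥0∞ :=
  ∫⁻ x in s, ‖u x - w x‖ₑ

theorem lOneDistOn_mono {s t : Set ℝ} (hst : s ⊆ t) (u w : ℝ → State n) :
    lOneDistOn s u w ≤ lOneDistOn t u w :=
  lintegral_mono_set hst

theorem lOneDistOn_union_le (s t : Set ℝ) (u w : ℝ → State n) :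
    lOneDistOn (s ∪ t) u w ≤ lOneDistOn s u w + lOneDistOn t u w :=
  lintegral_union_le _ _ _

theorem lOneDistOn_semigroup_le_of_eqOn {lam : ℝ} (hsf : IsSpeedBound Ω f Df Sf lam)
    (hsg : IsSpeedBound Ω g Dg Sg lam) (hD : Dg ⊆ Df) {v w : ℝ → State n} (hv : v ∈ Dg)
    (hw : w ∈ Dg) {a b h : ℝ} (hvw : ∀ x ∈ Ioo a b, v x = w x) (hh : 0 ≤ h) :
    lOneDistOn (Ioo (a + lam * h) (b - lam * h)) (Sf h v) (Sg h v) ≤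
      lOneDist (Sf h w) (Sg h w) := by
  refine le_trans (le_of_eq ?_) (setLIntegral_le_lOneDist _ _ (Ioo (a + lam * h) (b - lam * h)))
  refine setLIntegral_congr_fun measurableSet_Ioo fun x hx => ?_
  simp only [hsf.propagation v (hD hv) w (hD hw) a b hvw h hh x hx,
    hsg.propagation v hv w hw a b hvw h hh x hx]

/-- On either side of `x₀`, `v` differs from the outer value by at most the variation of the open
half-window. The jump at `x₀` itself is left out, so the factor of `ρ` tends to `0` with `ρ`. -/
theorem lOneDist_clamp_jump_le {v : ℝ → State n} (hv : BoundedVariationOn v univ) (x₀ : ℝ) {ρ : ℝ}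
    (hρ : 0 < ρ) : lOneDist (clamp (x₀ - ρ) (x₀ + ρ) v) (jump x₀ (v (x₀ - ρ)) (v (x₀ + ρ))) ≤
      ENNReal.ofReal (ρ * ((Function.leftLim (varFun v) x₀ - varFun v (x₀ - ρ)) +
        (varFun v (x₀ + ρ) - Function.rightLim (varFun v) x₀))) := by
  have hV := hv.monotone_varFun
  have h1 : 0 ≤ Function.leftLim (varFun v) x₀ - varFun v (x₀ - ρ) :=
    sub_nonneg.2 (hV.le_leftLim (by linarith))
  have h2 : 0 ≤ varFun v (x₀ + ρ) - Function.rightLim (varFun v) x₀ :=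
    sub_nonneg.2 (hV.rightLim_le (by linarith))
  have hpt : ∀ᵐ y, ‖clamp (x₀ - ρ) (x₀ + ρ) v y - jump x₀ (v (x₀ - ρ)) (v (x₀ + ρ)) y‖ₑ ≤
      (Ioo (x₀ - ρ) x₀).indicator
        (fun _ => ENNReal.ofReal (Function.leftLim (varFun v) x₀ - varFun v (x₀ - ρ))) y +
      (Ioo x₀ (x₀ + ρ)).indicator
        (fun _ => ENNReal.ofReal (varFun v (x₀ + ρ) - Function.rightLim (varFun v) x₀)) y := by
    filter_upwards [Measure.ae_ne volume x₀] with y hy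
    rcases lt_or_gt_of_ne hy with hlt | hgt
    · simp only [jump, if_pos hlt]
      rcases le_or_gt y (x₀ - ρ) with h | h
      · rw [clamp_of_le h]; simp
      · rw [clamp_of_mem ⟨h.le, by linarith⟩, indicator_of_mem (show y ∈ Ioo (x₀ - ρ) x₀ from
          ⟨h, hlt⟩), ← ofReal_norm, ← dist_eq_norm]
        refine le_add_right (ENNReal.ofReal_le_ofReal ((hv.dist_le_varFun_sub h.le).trans ?_))
        linarith [hV.le_leftLim hlt]
    · simp only [jump, if_neg hgt.not_gt]
      rcases le_or_gt (x₀ + ρ) y with h | h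
      · rw [clamp_of_ge (by linarith) h]; simp
      · rw [clamp_of_mem ⟨by linarith, h.le⟩, indicator_of_mem (show y ∈ Ioo x₀ (x₀ + ρ) from
          ⟨hgt, h⟩), ← ofReal_norm, ← dist_eq_norm, dist_comm]
        refine le_add_left (ENNReal.ofReal_le_ofReal ((hv.dist_le_varFun_sub h.le).trans ?_))
        linarith [hV.rightLim_le hgt]
  refine (lintegral_mono_ae hpt).trans (le_of_eq ?_)
  rw [lintegral_add_left (measurable_const.indicator measurableSet_Ioo),
    lintegral_indicator measurableSet_Ioo, lintegral_indicator measurableSet_Ioo,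
    setLIntegral_const, setLIntegral_const, Real.volume_Ioo, Real.volume_Ioo,
    ← ENNReal.ofReal_mul h1, ← ENNReal.ofReal_mul h2,
    ← ENNReal.ofReal_add (mul_nonneg h1 (by linarith)) (mul_nonneg h2 (by linarith))]
  congr 1
  ring

/-- The instantaneous distance of the semigroups near a point is bounded by the jump of the
variation function. -/
theorem eventually_lOneDistOn_window_le (hf : GeneratesSRS Ω f Df Sf)
    (hg : GeneratesSRS Ω g Dg Sg) (hD : Dg ⊆ Df) {d : ℝ≥0} (hd : riemannDist Dg Sf Sg ≤ d)
    {lam : ℝ} (hsf : IsSpeedBound Ω f Df Sf lam) (hsg : IsSpeedBound Ω g Dg Sg lam)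
    {v : ℝ → State n} (hv : v ∈ Dg) (x₀ : ℝ) {κ : ℝ} (hκ : 0 < κ) :
    ∀ᶠ h in 𝓝[>] (0 : ℝ), lOneDistOn (Icc (x₀ - lam * h) (x₀ + lam * h)) (Sf h v) (Sg h v) ≤
      ENNReal.ofReal (h * (d * (Function.rightLim (varFun v) x₀ - Function.leftLim (varFun v) x₀)
        + κ)) := by
  obtain ⟨Lf, hLf⟩ := hf.lipschitz
  obtain ⟨Lg, hLg⟩ := hg.lipschitz
  have hbv := hg.domain.boundedVariation v hv
  have hV := hbv.monotone_varFun
  have hlam := hsf.pos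
  have hR : Tendsto (fun h : ℝ => varFun v (x₀ + 2 * lam * h)) (𝓝[>] 0)
      (𝓝 (Function.rightLim (varFun v) x₀)) := by
    refine (hV.tendsto_rightLim x₀).comp (tendsto_nhdsWithin_iff.2 ⟨?_, ?_⟩)
    · have : Tendsto (fun h : ℝ => x₀ + 2 * lam * h) (𝓝 0) (𝓝 (x₀ + 2 * lam * 0)) :=
        (tendsto_id.const_mul _).const_add _
      rw [mul_zero, add_zero] at this
      exact this.mono_left nhdsWithin_le_nhds
    · filter_upwards [self_mem_nhdsWithin] with h hh
      have hh : 0 < h := hh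
      simp only [mem_Ioi, lt_add_iff_pos_right]
      positivity
  have hL : Tendsto (fun h : ℝ => varFun v (x₀ - 2 * lam * h)) (𝓝[>] 0)
      (𝓝 (Function.leftLim (varFun v) x₀)) := by
    refine (hV.tendsto_leftLim x₀).comp (tendsto_nhdsWithin_iff.2 ⟨?_, ?_⟩)
    · have : Tendsto (fun h : ℝ => x₀ - 2 * lam * h) (𝓝 0) (𝓝 (x₀ - 2 * lam * 0)) :=
        (tendsto_id.const_mul _).const_sub _
      rw [mul_zero, sub_zero] at this
      exact this.mono_left nhdsWithin_le_nhds
    · filter_upwards [self_mem_nhdsWithin] with h hh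
      have hh : 0 < h := hh
      simp only [mem_Iio, sub_lt_self_iff]
      positivity
  have hlim := ((hR.sub hL).const_mul (d : ℝ)).add
    (((hL.const_sub (Function.leftLim (varFun v) x₀)).add
      (hR.sub_const (Function.rightLim (varFun v) x₀))).const_mul ((Lf + Lg) * (2 * lam)))
  rw [sub_self, sub_self, add_zero, mul_zero] at hlim
  filter_upwards [hlim.eventually_lt_const (add_lt_add_right hκ _), self_mem_nhdsWithin]
    with h hlt hh
  have hh : 0 < h := hh
  -- At time `h`, the window of radius `lam * h` depends only on data within `2 * lam * h` of `x₀`.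
  set ρ := 2 * lam * h with hρ
  have hρ0 : 0 < ρ := by positivity
  have hab : x₀ - ρ ≤ x₀ + ρ := by linarith
  have hmem := hg.domain.clamp_mem hv (x₀ - ρ) (x₀ + ρ)
  have h1 := lOneDistOn_semigroup_le_of_eqOn hsf hsg hD hv hmem
    (a := x₀ - ρ) (b := x₀ + ρ) (fun x hx => (clamp_of_mem (Ioo_subset_Icc_self hx)).symm) hh.le
  have h2 : lOneDistOn (Icc (x₀ - lam * h) (x₀ + lam * h)) (Sf h v) (Sg h v) =
      lOneDistOn (Ioo (x₀ - ρ + lam * h) (x₀ + ρ - lam * h)) (Sf h v) (Sg h v) := by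
    rw [show x₀ - ρ + lam * h = x₀ - lam * h by rw [hρ]; ring,
      show x₀ + ρ - lam * h = x₀ + lam * h by rw [hρ]; ring]
    exact (setLIntegral_congr Ioo_ae_eq_Icc).symm
  have h3 := lOneDist_semigroup_le_of_approx hf hg hD hLf hLg hmem
    (hg.domain.jump_mem hv hab x₀) hh.le
  have h4 := lOneDist_semigroup_jump_le hf hg hD hd (hg.domain.riemannDatum_mem hv hab) x₀ hh
  have h5 := lOneDist_clamp_jump_le hbv x₀ hρ0
  have h6 : ‖v (x₀ + ρ) - v (x₀ - ρ)‖ ≤ varFun v (x₀ + ρ) - varFun v (x₀ - ρ) := by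
    rw [← dist_eq_norm]; exact hbv.dist_le_varFun_sub hab
  have h7 : 0 ≤ Function.leftLim (varFun v) x₀ - varFun v (x₀ - ρ) :=
    sub_nonneg.2 (hV.le_leftLim (by linarith))
  have h8 : 0 ≤ varFun v (x₀ + ρ) - Function.rightLim (varFun v) x₀ :=
    sub_nonneg.2 (hV.rightLim_le (by linarith))
  rw [h2]
  refine (h1.trans h3).trans ((add_le_add h4 (mul_le_mul_right h5 _)).trans ?_)
  rw [← ENNReal.coe_add, ← ENNReal.ofReal_coe_nnreal, ← ENNReal.ofReal_mul (by positivity),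
    ← ENNReal.ofReal_add (by positivity) (by positivity)]
  refine ENNReal.ofReal_le_ofReal ?_
  have h9 : (d : ℝ) * ‖v (x₀ + ρ) - v (x₀ - ρ)‖ ≤ d * (varFun v (x₀ + ρ) - varFun v (x₀ - ρ)) := by
    gcongr
  push_cast
  have h10 : ((Lf : ℝ) + Lg) * (ρ * ((Function.leftLim (varFun v) x₀ - varFun v (x₀ - ρ)) +
      (varFun v (x₀ + ρ) - Function.rightLim (varFun v) x₀))) = h * ((Lf + Lg) * (2 * lam) *
      ((Function.leftLim (varFun v) x₀ - varFun v (x₀ - ρ)) +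
      (varFun v (x₀ + ρ) - Function.rightLim (varFun v) x₀))) := by
    rw [hρ]; ring
  rw [h10, ← mul_add]
  refine mul_le_mul_of_nonneg_left ?_ hh.le
  linarith

end Instantaneous

/-! ### Summing the local estimates -/

section Combination

variable {n : ℕ} {Ω : Set (State n)} {f g : State n → State n} {Df Dg : Set (ℝ → State n)}
  {Sf Sg : ℝ → (ℝ → State n) → ℝ → State n}

/-- Truncating at distance `lam * h` inside the interval excludes jumps of `v` at `a` and `b`, so
only the variation in the open interval is charged; propagation costs another `lam * h`. The same
`δ` serves all intervals and all `h`. -/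
theorem exists_lOneDistOn_Ioo_le (hf : GeneratesSRS Ω f Df Sf)
    (hg : GeneratesSRS Ω g Dg Sg) (hD : Dg ⊆ Df) {d : ℝ≥0} (hd : riemannDist Dg Sf Sg ≤ d)
    {lam : ℝ} (hsf : IsSpeedBound Ω f Df Sf lam) (hsg : IsSpeedBound Ω g Dg Sg lam)
    {v : ℝ → State n} (hv : v ∈ Dg) {ε : ℝ} (hε : 0 < ε) :
    ∃ δ > 0, ∀ a b, a < b →
      Function.leftLim (varFun v) b - Function.rightLim (varFun v) a ≤ δ → ∀ h, 0 < h →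
      lOneDistOn (Ioo (a + 2 * lam * h) (b - 2 * lam * h)) (Sf h v) (Sg h v) ≤
        ENNReal.ofReal (h * ((d + ε) *
          (Function.leftLim (varFun v) b - Function.rightLim (varFun v) a))) := by
  obtain ⟨K, hKΩ, hK, hvK⟩ := hg.domain.range v hv
  obtain ⟨δ, hδ, H⟩ := exists_forall_lOneDist_semigroup_clamp_le hf hg hD hd hK hKΩ hε
  have hV := (hg.domain.boundedVariation v hv).monotone_varFun
  refine ⟨δ, hδ, fun a b hab hvar h hh => ?_⟩
  have hlh := mul_pos hsf.pos hh
  rcases le_or_gt (b - lam * h) (a + lam * h) with hle | hlt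
  · rw [Ioo_eq_empty (by linarith)]
    simp [lOneDistOn]
  have h1 : varFun v (b - lam * h) - varFun v (a + lam * h) ≤
      Function.leftLim (varFun v) b - Function.rightLim (varFun v) a :=
    sub_le_sub (hV.le_leftLim (by linarith)) (hV.rightLim_le (by linarith))
  have h2 := lOneDistOn_semigroup_le_of_eqOn hsf hsg hD hv
    (hg.domain.clamp_mem hv (a + lam * h) (b - lam * h)) (a := a + lam * h) (b := b - lam * h)
    (fun x hx => (clamp_of_mem (Ioo_subset_Icc_self hx)).symm) hh.le
  rw [show a + 2 * lam * h = a + lam * h + lam * h by ring,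
    show b - 2 * lam * h = b - lam * h - lam * h by ring]
  refine (h2.trans (H v hv _ _ hlt.le (hvK _) (h1.trans hvar) h hh)).trans ?_
  gcongr

theorem Monotone.exists_tails_le {V : ℝ → ℝ} (hV : Monotone V) {C : ℝ}
    (hC : ∀ a b, V b - V a ≤ C) {δ : ℝ} (hδ : 0 < δ) :
    ∃ M > 0, (∀ b, M ≤ b → V b - V M ≤ δ) ∧ ∀ a, a ≤ -M → V (-M) - V a ≤ δ := by
  have hA : BddAbove (range V) := ⟨V 0 + C, by rintro _ ⟨x, rfl⟩; linarith [hC 0 x]⟩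
  have hB : BddBelow (range V) := ⟨V 0 - C, by rintro _ ⟨x, rfl⟩; linarith [hC x 0]⟩
  obtain ⟨x, hx⟩ := exists_lt_of_lt_ciSup (sub_lt_self (⨆ x, V x) hδ)
  obtain ⟨y, hy⟩ := exists_lt_of_ciInf_lt (lt_add_of_pos_right (⨅ x, V x) hδ)
  refine ⟨|x| + |y| + 1, by positivity, fun b _ => ?_, fun a _ => ?_⟩
  · have h1 := le_ciSup hA b
    have h2 := hV (show x ≤ |x| + |y| + 1 by linarith [le_abs_self x, abs_nonneg y])
    linarith
  · have h1 := ciInf_le hB a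
    have h2 := hV (show -(|x| + |y| + 1) ≤ y by linarith [neg_abs_le y, abs_nonneg x])
    linarith

theorem eventually_lOneDist_semigroup_le_add (hf : GeneratesSRS Ω f Df Sf)
    (hg : GeneratesSRS Ω g Dg Sg) (hD : Dg ⊆ Df) {d : ℝ≥0} (hd : riemannDist Dg Sf Sg ≤ d)
    {v : ℝ → State n} (hv : v ∈ Dg) {ε : ℝ} (hε : 0 < ε) :
    ∀ᶠ h in 𝓝[>] (0 : ℝ), lOneDist (Sf h v) (Sg h v) ≤
      ENNReal.ofReal (h * ((d + ε) * (totVar v).toReal + 3 * ε)) := by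
  obtain ⟨lamf, hlamf⟩ := hf.exists_isSpeedBound
  obtain ⟨lamg, hlamg⟩ := hg.exists_isSpeedBound
  set lam := max lamf lamg with hlam
  have hsf := hlamf lam (le_max_left _ _)
  have hsg := hlamg lam (le_max_right _ _)
  have hpos := hsf.pos
  -- With speed bound `2 * lam` the windows have radius `2 * lam * h`, exactly what the estimate on
  -- open intervals leaves uncovered at their ends.
  have hsf2 := hlamf (2 * lam) ((le_max_left lamf lamg).trans (by linarith))
  have hsg2 := hlamg (2 * lam) ((le_max_right lamf lamg).trans (by linarith))
  have hbv := hg.domain.boundedVariation v hv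
  have hV := hbv.monotone_varFun
  set V := varFun v with hVdef
  obtain ⟨δ, hδ, hsmall⟩ := exists_lOneDistOn_Ioo_le hf hg hD hd hsf hsg hv hε
  have hjump := fun (x₀ κ : ℝ) (hκ : 0 < κ) =>
    eventually_lOneDistOn_window_le hf hg hD hd hsf2 hsg2 hv x₀ hκ
  have hlr : ∀ x, Function.leftLim V x ≤ Function.rightLim V x := fun x =>
    hV.leftLim_le_rightLim le_rfl
  have hrl : ∀ {a b}, a < b → Function.rightLim V a ≤ Function.leftLim V b := fun {a b} hab =>
    hV.rightLim_le_leftLim hab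
  -- The variation charged excludes the jumps of `V` at `a` and `b`; when two such intervals are
  -- joined, the window at the common end supplies its jump.
  let E : ℝ → ℝ → Prop := fun a b => a < b ∧ ∀ κ : ℝ, 0 < κ → ∀ᶠ h in 𝓝[>] (0 : ℝ),
    lOneDistOn (Ioo (a + 2 * lam * h) (b - 2 * lam * h)) (Sf h v) (Sg h v) ≤
      ENNReal.ofReal (h * ((d + ε) * (Function.leftLim V b - Function.rightLim V a) + κ))
  have hEsmall : ∀ a b, a < b → Function.leftLim V b - Function.rightLim V a ≤ δ → E a b := by
    refine fun a b hab hle => ⟨hab, fun κ hκ => ?_⟩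
    filter_upwards [self_mem_nhdsWithin] with h hh
    refine (hsmall a b hab hle h hh).trans (ENNReal.ofReal_le_ofReal ?_)
    have hh : 0 < h := hh
    gcongr
    linarith
  have hEtrans : ∀ a b c, a < b → b < c → E a b → E b c → E a c := by
    rintro a b c hab hbc ⟨-, h1⟩ ⟨-, h2⟩
    refine ⟨hab.trans hbc, fun κ hκ => ?_⟩
    filter_upwards [h1 (κ / 3) (by positivity), h2 (κ / 3) (by positivity),
      hjump b (κ / 3) (by positivity), self_mem_nhdsWithin] with h e1 e2 e3 hh
    have hh : 0 < h := hh
    have hsub : Ioo (a + 2 * lam * h) (c - 2 * lam * h) ⊆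
        Ioo (a + 2 * lam * h) (b - 2 * lam * h) ∪
          (Icc (b - 2 * lam * h) (b + 2 * lam * h) ∪
            Ioo (b + 2 * lam * h) (c - 2 * lam * h)) := by
      intro x hx
      rcases lt_or_ge x (b - 2 * lam * h) with h3 | h3
      · exact Or.inl ⟨hx.1, h3⟩
      rcases le_or_gt x (b + 2 * lam * h) with h4 | h4
      · exact Or.inr (Or.inl ⟨h3, h4⟩)
      · exact Or.inr (Or.inr ⟨h4, hx.2⟩)
    refine ((lOneDistOn_mono hsub _ _).trans ((lOneDistOn_union_le _ _ _ _).trans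
      (add_le_add e1 ((lOneDistOn_union_le _ _ _ _).trans (add_le_add e3 e2))))).trans ?_
    have p1 := sub_nonneg.2 (hrl hab)
    have p2 := sub_nonneg.2 (hrl hbc)
    have p3 := sub_nonneg.2 (hlr b)
    rw [← ENNReal.ofReal_add (by positivity) (by positivity),
      ← ENNReal.ofReal_add (by positivity) (by positivity), ← mul_add, ← mul_add]
    refine ENNReal.ofReal_le_ofReal (mul_le_mul_of_nonneg_left ?_ hh.le)
    linarith [mul_nonneg hε.le p3]
  have hEright : ∀ x, ∀ᶠ y in 𝓝[>] x, E x y := by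
    intro x
    filter_upwards [(hV.tendsto_rightLim x).eventually_lt_const (lt_add_of_pos_right _ hδ),
      self_mem_nhdsWithin] with y hy hxy
    exact hEsmall x y hxy (by linarith [hV.leftLim_le (le_refl y)])
  have hEleft : ∀ x, ∀ᶠ y in 𝓝[<] x, E y x := by
    intro x
    filter_upwards [(hV.tendsto_leftLim x).eventually_const_lt (sub_lt_self _ hδ),
      self_mem_nhdsWithin] with y hy hxy
    exact hEsmall y x hxy (by linarith [hV.le_rightLim (le_refl y)])
  obtain ⟨M, hM, hM1, hM2⟩ := hV.exists_tails_le hbv.varFun_sub_le hδ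
  have hmid := (rel_of_forall_eventually_of_trans hEtrans hEright hEleft
    (show -M < M by linarith)).2 ε hε
  filter_upwards [hmid, hjump (-M) ε hε, hjump M ε hε, self_mem_nhdsWithin] with h e1 e2 e3 hh
  have hh : 0 < h := hh
  have hlh : 0 < 2 * lam * h := by positivity
  -- Beyond `±M` the variation is at most `δ`, so each tail is a single small interval of any
  -- length, with `h` fixed before `N`. The term `3 * ε` comes from the middle interval and the two
  -- windows at `±M`.
  have hN : ∀ N : ℕ, lOneDistOn (Ioo (-(N : ℝ)) N) (Sf h v) (Sg h v) ≤
      ENNReal.ofReal (h * ((d + ε) * (totVar v).toReal + 3 * ε)) := by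
    intro N
    set a := -M - (N + 1) - 2 * lam * h with ha
    set b := M + (N + 1) + 2 * lam * h with hb
    have hN0 : (0 : ℝ) ≤ N := N.cast_nonneg
    have haM : a < -M := by linarith
    have hMb : M < b := by linarith
    have e4 := hsmall a (-M) haM (by
      linarith [hM2 a haM.le, hV.leftLim_le (le_refl (-M)), hV.le_rightLim (le_refl a)]) h hh
    have e5 := hsmall M b hMb (by
      linarith [hM1 b hMb.le, hV.leftLim_le (le_refl b), hV.le_rightLim (le_refl M)]) h hh
    have hsub : Ioo (-(N : ℝ)) N ⊆ Ioo (a + 2 * lam * h) (-M - 2 * lam * h) ∪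
        (Icc (-M - 2 * lam * h) (-M + 2 * lam * h) ∪
          (Ioo (-M + 2 * lam * h) (M - 2 * lam * h) ∪
            (Icc (M - 2 * lam * h) (M + 2 * lam * h) ∪
              Ioo (M + 2 * lam * h) (b - 2 * lam * h)))) := by
      intro x hx
      rcases lt_or_ge x (-M - 2 * lam * h) with h3 | h3
      · exact Or.inl ⟨by linarith [hx.1], h3⟩
      rcases le_or_gt x (-M + 2 * lam * h) with h4 | h4
      · exact Or.inr (Or.inl ⟨h3, h4⟩)
      rcases lt_or_ge x (M - 2 * lam * h) with h5 | h5
      · exact Or.inr (Or.inr (Or.inl ⟨h4, h5⟩))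
      rcases le_or_gt x (M + 2 * lam * h) with h6 | h6
      · exact Or.inr (Or.inr (Or.inr (Or.inl ⟨h5, h6⟩)))
      · exact Or.inr (Or.inr (Or.inr (Or.inr ⟨h6, by linarith [hx.2]⟩)))
    refine ((lOneDistOn_mono hsub _ _).trans ((lOneDistOn_union_le _ _ _ _).trans
      (add_le_add e4 ((lOneDistOn_union_le _ _ _ _).trans (add_le_add e2
        ((lOneDistOn_union_le _ _ _ _).trans (add_le_add e1
          ((lOneDistOn_union_le _ _ _ _).trans (add_le_add e3 e5))))))))).trans ?_
    have p1 := sub_nonneg.2 (hrl haM)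
    have p2 := sub_nonneg.2 (hrl hMb)
    have p3 := sub_nonneg.2 (hlr M)
    have p4 := sub_nonneg.2 (hlr (-M))
    have p5 := sub_nonneg.2 (hrl (show -M < M by linarith))
    rw [← ENNReal.ofReal_add (by positivity) (by positivity),
      ← ENNReal.ofReal_add (by positivity) (by positivity),
      ← ENNReal.ofReal_add (by positivity) (by positivity),
      ← ENNReal.ofReal_add (by positivity) (by positivity), ← mul_add, ← mul_add, ← mul_add,
      ← mul_add]
    refine ENNReal.ofReal_le_ofReal (mul_le_mul_of_nonneg_left ?_ hh.le)
    have p6 : Function.leftLim V b - Function.rightLim V a ≤ (totVar v).toReal := by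
      have := hbv.varFun_sub_le a b
      unfold totVar
      linarith [hV.leftLim_le (le_refl b), hV.le_rightLim (le_refl a)]
    have p7 := mul_le_mul_of_nonneg_left p6 (show 0 ≤ (d : ℝ) + ε by positivity)
    linarith [mul_nonneg hε.le p3, mul_nonneg hε.le p4]
  have hmeas : Measurable fun x => ‖Sf h v x - Sg h v x‖ₑ :=
    ((hf.domain.measurable (hf.mapsTo h hh.le v (hD hv))).sub
      (hg.domain.measurable (hg.mapsTo h hh.le v hv))).enorm
  have hcover : AECover volume atTop fun N : ℕ => Ioo (-(N : ℝ)) N :=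
    aecover_Ioo (tendsto_neg_atTop_atBot.comp tendsto_natCast_atTop_atTop)
      tendsto_natCast_atTop_atTop
  exact le_of_tendsto' (hcover.lintegral_tendsto_of_nat hmeas.aemeasurable) hN

/-- The instantaneous distance of the trajectories of the two semigroups. -/
theorem eventually_lOneDist_semigroup_le (hf : GeneratesSRS Ω f Df Sf)
    (hg : GeneratesSRS Ω g Dg Sg) (hD : Dg ⊆ Df) {d : ℝ≥0} (hd : riemannDist Dg Sf Sg ≤ d)
    {v : ℝ → State n} (hv : v ∈ Dg) {κ : ℝ} (hκ : 0 < κ) :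
    ∀ᶠ h in 𝓝[>] (0 : ℝ), lOneDist (Sg h v) (Sf h v) ≤
      ENNReal.ofReal h * (d * totVar v + ENNReal.ofReal κ) := by
  have hfin : totVar v ≠ ∞ := hg.domain.boundedVariation v hv
  set T := (totVar v).toReal with hT
  have hT0 : 0 ≤ T := ENNReal.toReal_nonneg
  -- For this `ε`, `(d + ε) T + 3 ε = d T + κ`.
  filter_upwards [eventually_lOneDist_semigroup_le_add hf hg hD hd hv
    (show 0 < κ / (T + 3) by positivity), self_mem_nhdsWithin] with h e hh
  have hh : 0 < h := hh
  rw [← hT] at e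
  rw [lOneDist_comm]
  refine e.trans ?_
  rw [← ENNReal.ofReal_toReal hfin, ← ENNReal.ofReal_coe_nnreal,
    ← ENNReal.ofReal_mul (by positivity), ← ENNReal.ofReal_add (by positivity) hκ.le,
    ← ENNReal.ofReal_mul hh.le, ← hT]
  refine ENNReal.ofReal_le_ofReal (mul_le_mul_of_nonneg_left (le_of_eq ?_) hh.le)
  field_simp
  ring

/-- Lower semicontinuity of the total variation along a trajectory, at the initial time. -/
theorem GeneratesSRS.exists_forall_le_totVar (hg : GeneratesSRS Ω g Dg Sg) {u : ℝ → State n}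
    (hu : u ∈ Dg) (hTV : totVar u ≠ 0) :
    ∃ e > 0, ∃ s₀ > 0, ∀ s ∈ Ioc 0 s₀, ENNReal.ofReal e ≤ totVar (Sg s u) := by
  obtain ⟨L, hL⟩ := hg.lipschitz
  have hL0 : (0 : ℝ) < L := hL.1
  obtain ⟨x, y, hxy⟩ : ∃ x y, u x ≠ u y := by
    by_contra! h
    exact hTV ((eVariationOn.eq_zero_iff u).2 fun x _ y _ => by rw [h x y, edist_self])
  set e := ‖u y - u x‖ with he
  have he0 : 0 < e := norm_pos_iff.2 (sub_ne_zero.2 hxy.symm)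
  have hnear : ∀ x, ∃ r > 0, ∀ z ∈ Ico 0 r, ‖u (x + z) - u x‖ < e / 4 := by
    intro x
    obtain ⟨r, hr, h⟩ := Metric.continuousWithinAt_iff.1 (hg.domain.rightCont u hu x) (e / 4)
      (by positivity)
    refine ⟨r, hr, fun z hz => ?_⟩
    rw [← dist_eq_norm]
    exact h (by simpa using hz.1) (by simpa [abs_of_nonneg hz.1] using hz.2)
  obtain ⟨r₁, hr₁, h1⟩ := hnear x
  obtain ⟨r₂, hr₂, h2⟩ := hnear y
  set r := min r₁ r₂ with hr
  have hr0 : 0 < r := lt_min hr₁ hr₂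
  -- Up to time `r e / (8 L)` the trajectory moves by at most `r e / 8` in `L¹`. Averaging the
  -- increments between `x + z` and `y + z` over `z ∈ (0, r)` gives `e / 2 ≤ TV(w) + e / 4`.
  refine ⟨e / 4, by positivity, r * e / (8 * L), by positivity, fun s hs => ?_⟩
  set w := Sg s u with hw
  have hwD : w ∈ Dg := hg.mapsTo s hs.1.le u hu
  have hdist : lOneDist w u ≤ ENNReal.ofReal (r * e / 8) := by
    have := hL.2 s 0 hs.1.le le_rfl u hu u hu
    rw [hg.zero u hu, lOneDist_self, add_zero, sub_zero, abs_of_pos hs.1] at this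
    refine this.trans ?_
    rw [← ENNReal.ofReal_coe_nnreal, ← ENNReal.ofReal_mul hL0.le]
    refine ENNReal.ofReal_le_ofReal ((mul_le_mul_of_nonneg_left hs.2 hL0.le).trans (le_of_eq ?_))
    field_simp
  by_contra! hlt
  have hmeas : Measurable fun z => ‖w z - u z‖ₑ :=
    ((hg.domain.measurable hwD).sub (hg.domain.measurable hu)).enorm
  have hpt : ∀ z ∈ Ioo 0 r, ENNReal.ofReal (e / 2) ≤
      totVar w + (‖w (y + z) - u (y + z)‖ₑ + ‖w (x + z) - u (x + z)‖ₑ) := by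
    intro z hz
    have h3 : edist (w (y + z)) (w (x + z)) ≤ totVar w :=
      eVariationOn.edist_le w (mem_univ _) (mem_univ _)
    refine le_trans ?_ (add_le_add_left h3 _)
    rw [edist_eq_enorm_sub, ← ofReal_norm, ← ofReal_norm, ← ofReal_norm,
      ← ENNReal.ofReal_add (by positivity) (by positivity),
      ← ENNReal.ofReal_add (by positivity) (by positivity)]
    refine ENNReal.ofReal_le_ofReal ?_
    have h4 := h1 z ⟨hz.1.le, hz.2.trans_le (min_le_left _ _)⟩
    have h5 := h2 z ⟨hz.1.le, hz.2.trans_le (min_le_right _ _)⟩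
    have h6 : u y - u x = (w (y + z) - w (x + z)) - (w (y + z) - u (y + z))
        + (w (x + z) - u (x + z)) - (u (y + z) - u y) + (u (x + z) - u x) := by abel
    have h7 : e ≤ ‖w (y + z) - w (x + z)‖ + ‖w (y + z) - u (y + z)‖ + ‖w (x + z) - u (x + z)‖
        + ‖u (y + z) - u y‖ + ‖u (x + z) - u x‖ := by
      rw [he, h6]
      refine (norm_add_le _ _).trans (add_le_add_left ?_ _)
      refine (norm_sub_le _ _).trans (add_le_add_left ?_ _)
      refine (norm_add_le _ _).trans (add_le_add_left ?_ _)
      exact norm_sub_le _ _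
    linarith
  have hshift : ∀ a, ∫⁻ z in Ioo 0 r, ‖w (a + z) - u (a + z)‖ₑ ≤ ENNReal.ofReal (r * e / 8) :=
    fun a => (setLIntegral_le_lintegral _ _).trans
      ((lintegral_add_left_eq_self (fun z => ‖w z - u z‖ₑ) a).le.trans hdist)
  have hmeas' : ∀ a, Measurable fun z => ‖w (a + z) - u (a + z)‖ₑ := fun a =>
    hmeas.comp (measurable_const_add a)
  have hint : ENNReal.ofReal (e / 2) * ENNReal.ofReal r ≤ totVar w * ENNReal.ofReal r +
      (ENNReal.ofReal (r * e / 8) + ENNReal.ofReal (r * e / 8)) := by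
    have h3 := setLIntegral_mono' (μ := volume) measurableSet_Ioo hpt
    rw [setLIntegral_const, Real.volume_Ioo, sub_zero, lintegral_add_left measurable_const,
      setLIntegral_const, Real.volume_Ioo, sub_zero, lintegral_add_left (hmeas' y)] at h3
    exact h3.trans (add_le_add_right (add_le_add (hshift y) (hshift x)) _)
  have hTfin : totVar w ≠ ∞ := hlt.ne_top
  have hTe : (totVar w).toReal < e / 4 := (ENNReal.lt_ofReal_iff_toReal_lt hTfin).1 hlt
  rw [← ENNReal.ofReal_toReal hTfin, ← ENNReal.ofReal_mul (by positivity),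
    ← ENNReal.ofReal_mul ENNReal.toReal_nonneg,
    ← ENNReal.ofReal_add (by positivity) (by positivity),
    ← ENNReal.ofReal_add (by positivity) (by positivity),
    ENNReal.ofReal_le_ofReal_iff (by positivity)] at hint
  nlinarith

end Combination

/-! ### The main estimate -/

theorem theoremT {n : ℕ} (Ω : Set (State n)) (f g : State n → State n)
    (Df Dg : Set (ℝ → State n)) (Sf Sg : ℝ → (ℝ → State n) → ℝ → State n)
    (hf : GeneratesSRS Ω f Df Sf) (hg : GeneratesSRS Ω g Dg Sg) (hD : Dg ⊆ Df)
    (Lf : ℝ≥0) (hLf : IsLipschitzConst Df Sf Lf)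
    (u : ℝ → State n) (hu : u ∈ Dg) (t : ℝ) (ht : 0 ≤ t) :
    lOneDist (Sf t u) (Sg t u) ≤
      Lf * riemannDist Dg Sf Sg * ∫⁻ s in Ioc 0 t, totVar (Sg s u) := by
  rcases ht.eq_or_lt with rfl | ht0
  · simp [hf.zero u (hD hu), hg.zero u hu]
  rcases eq_or_ne (riemannDist Dg Sf Sg) ∞ with htop | hfin
  -- The right-hand side is `∞` as soon as the integral is positive; only constant `u` remains, and
  -- there the left-hand side vanishes.
  · by_cases hTV : totVar u = 0
    · have hc : u = fun _ => u 0 := funext fun x =>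
        edist_eq_zero.1 ((eVariationOn.eq_zero_iff u).1 hTV x (mem_univ x) 0 (mem_univ 0))
      rw [hc] at hu ⊢
      rw [hf.apply_const (hD hu) ht, hg.apply_const hu ht, lOneDist_self]
      exact zero_le
    · obtain ⟨e, he, s₀, hs₀, h⟩ := hg.exists_forall_le_totVar hu hTV
      have hpos : ∫⁻ s in Ioc 0 t, totVar (Sg s u) ≠ 0 := by
        refine ne_of_gt (lt_of_lt_of_le ?_ (lintegral_mono_set
          (Ioc_subset_Ioc_right (min_le_left t s₀))))
        refine lt_of_lt_of_le ?_ (setLIntegral_mono' measurableSet_Ioc fun s hs =>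
          h s ⟨hs.1, hs.2.trans (min_le_right _ _)⟩)
        rw [setLIntegral_const, Real.volume_Ioc, sub_zero,
          ← ENNReal.ofReal_mul he.le, ENNReal.ofReal_pos]
        positivity
      have hL : (Lf : ℝ≥0∞) ≠ 0 := by exact_mod_cast hLf.1.ne'
      rw [htop, ENNReal.mul_top hL, ENNReal.top_mul hpos]
      exact le_top
  · obtain ⟨Lg, hLg⟩ := hg.lipschitz
    lift riemannDist Dg Sf Sg to ℝ≥0 using hfin with d hd
    -- The trajectory of `g` is the approximate solution and `Sf` the exact semigroup, which is why
    -- `Lf` and the variation of `Sg s u` appear.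
    have key := lOneDist_semigroup_le_lintegral (fun u hu => hf.domain.measurable hu)
      hf.mapsTo hf.zero hf.add hLf (w := fun s => Sg s u) ht
      (fun s hs => hD (hg.mapsTo s hs.1 u hu)) Lg
      (fun s hs r hr => by simpa using hLg.2 s r hs.1 hr.1 u hu u hu)
      (fun s => d * totVar (Sg s u)) (fun s hs κ hκ => ?_)
    · rw [hg.zero u hu, lOneDist_comm, lintegral_const_mul' _ _ ENNReal.coe_ne_top, ← mul_assoc]
        at key
      exact key
    · filter_upwards [eventually_lOneDist_semigroup_le hf hg hD hd.ge (hg.mapsTo s hs.1 u hu) hκ,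
        self_mem_nhdsWithin] with θ h hθ
      rwa [hg.add θ s (le_of_lt hθ) hs.1 u hu, add_comm θ s] at h
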